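/- **Setting (space-time random walk in random environment).** Let $d\ge 1$ and $U=\{z\in\mathbb Z^d:|z_1|+\cdots+|z_d|=1\}$. An environment is $\omega=(\omega_{n,x})_{n\in\mathbb Z,\,x\in\mathbb Z^d}$, where $\omega_{n,x}=(\pi_{n,n+1}(x,x+z))_{z\in U}$ is a probability vector on $U$; $\Omega$ is the space of environments with its product $\sigma$-algebra. Let $\mathbb P$ be a probability measure on $\Omega$ under which the $\omega_{n,x}$ are i.i.d. and uniformly elliptic: for some $c_1>0$, $\mathbb P(\pi_{0,1}(0,z)\ge c_1)=1$ for all $z\in U$. For $\omega\in\Omega$, $P^\omega_{0,0}$ is the law of the walk $(X_n)_{n\ge0}$ with $X_0=0$ that jumps from $x$ at time $n$ to $x+z$ at time $n+1$ with probability $\pi_{n,n+1}(x,x+z)$, and $E_{0,0}$ is expectation under the averaged law $P_{0,0}=\mathbb P\times P^\omega_{0,0}$. Write $Z_i=X_i-X_{i-1}$, $(T_{m,y}\omega)_{n,x}=\omega_{n+m,x+y}$, and $$\bar\nu^\infty_{n,X}=\frac1n\sum_{j=0}^{n-1}\delta_{(T_{j,X_j}\omega,\,(Z_{j+i})_{i\ge1})}$$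 for the empirical process, a random measure on $\Omega\times U^{\mathbb N}$. Put $q(z)=\mathbb E[\pi_{0,1}(0,z)]$, $\Lambda_c(\theta)=\log\sum_{z\in U}q(z)e^{\langle\theta,z\rangle}$ for $\theta\in\mathbb R^d$, $I_c(\xi)=\sup_{\theta}(\langle\theta,\xi\rangle-\Lambda_c(\theta))$, and $\mathcal D=\{\xi\in\mathbb R^d:|\xi_1|+\cdots+|\xi_d|\le1\}$. For $N,M,K\in\mathbb N$ let $\mathcal F_{N,M,K}$ be the set of bounded $f:\Omega\times U^{\mathbb N}\to\mathbb R$ such that $f(\cdot,(z_i)_{i\ge1})$ does not depend on $(z_i)_{i>K}$ and, for each $(z_i)_{i\ge1}$, is measurable both with respect to $\sigma(\omega_{m,x}:m\ge-N,\,x\in\mathbb Z^d)$ and with respect to $\sigma(\omega_{m,x}:m\le M,\,x\in\mathbb Z^d)$. **Hypothesis.** Let $\xi$ be in the interior $\mathcal D^o$, and assume that the quenched LDP for the mean velocity holds in a neighborhood of $\xi$ with rate $I_c(\xi)$ at $\xi$: there are $\eta>0$ and a deterministic $I:\mathbb R^d\to[0,\infty]$, lower semicontinuous on the open ball $B(\xi,\eta)$,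 with $I(\xi)=I_c(\xi)$, such that for $\mathbb P$-a.e. $\omega$ and every Borel set $G$ with $\bar G\subset B(\xi,\eta)$, $$-\inf_{G^o}I\le\liminf_{n\to\infty}\tfrac1n\log P^\omega_{0,0}\big(\tfrac{X_n}n\in G\big)\le\limsup_{n\to\infty}\tfrac1n\log P^\omega_{0,0}\big(\tfrac{X_n}n\in G\big)\le-\inf_{\bar G}I .$$ **Conclusion.** There is exactly one measure $\bar\mu^\infty_\xi$ on $\Omega\times U^{\mathbb N}$ for which there is a $\theta\in\mathbb R^d$ with $\nabla\Lambda_c(\theta)=\xi$ and, for all $N,M,K\in\mathbb N$ and $f\in\mathcal F_{N,M,K}$, $$\int f\,d\bar\mu^\infty_\xi=E_{0,0}\Big[e^{\langle\theta,X_{N+M+K+1}\rangle-(N+M+K+1)\Lambda_c(\theta)}\,f\big(T_{N,X_N}\omega,(Z_{N+i})_{i\ge1}\big)\Big].$$ Moreover, for all $N,M,K\in\mathbb N$ and $f\in\mathcal F_{N,M,K}$, for $\mathbb P$-a.e. $\omega$ (the null set may depend on $f$) and every $\epsilon>0$, $$\limsup_{\delta\to0^+}\ \limsup_{n\to\infty}\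 \frac1n\log P^\omega_{0,0}\Big(\Big|\int f\,d\bar\nu^\infty_{n,X}-\int f\,d\bar\mu^\infty_\xi\Big|>\epsilon\ \Big|\ \Big|\frac{X_n}n-\xi\Big|\le\delta\Big)<0 .$$ -/

import Mathlib

open MeasureTheory ProbabilityTheory Filter Topology
open scoped ENNReal

namespace SpaceTimeRWRE

noncomputable section

/-- Points of the lattice `ℤ^d`. -/
abbrev Site (d : ℕ) : Type := Fin d → ℤ

/-- The set `U` of nearest-neighbour steps: `z ∈ ℤ^d` with `|z₁| + ⋯ + |z_d| = 1`. -/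
abbrev Step (d : ℕ) : Type := {z : Site d // ∑ i, |z i| = 1}

instance instFiniteStep (d : ℕ) : Finite (Step d) := by
  refine Set.Finite.subset (Set.finite_Icc (fun _ : Fin d => (-1 : ℤ)) (fun _ => 1)) ?_
  intro z hz
  have h : ∀ i, |z i| ≤ 1 := fun i => by
    have h1 : |z i| ≤ ∑ j, |z j| :=
      Finset.single_le_sum (f := fun j => |z j|) (fun j _ => abs_nonneg _) (Finset.mem_univ i)
    have h2 : ∑ j, |z j| = 1 := hz
    omega
  exact ⟨fun i => (abs_le.mp (h i)).1, fun i => (abs_le.mp (h i)).2⟩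

instance instFintypeStep (d : ℕ) : Fintype (Step d) := Fintype.ofFinite _

/-- Probability vectors on `U`: the possible values of the environment at one space-time point. -/
abbrev SiteEnv (d : ℕ) : Type := {p : Step d → ℝ // (∀ z, 0 ≤ p z) ∧ ∑ z, p z = 1}

/-- Space-time environments. For `ω : Env d`, the number `(ω (n, x)).1 z` is the probability
`π_{n,n+1}(x, x + z)` of jumping from `x` to `x + z` at time `n`. The σ-algebra is the product one. -/
abbrev Env (d : ℕ) : Type := ℤ × Site d → SiteEnv d

/-- The space-time shift: `(T_{m,y} ω)_{n,x} = ω_{n+m,x+y}`. -/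
def shift {d : ℕ} (m : ℤ) (y : Site d) (ω : Env d) : Env d := fun p => ω (p.1 + m, p.2 + y)

/-- The σ-algebra generated by `ω_{m,x}` with `m ≤ n` and arbitrary `x`. -/
abbrev pastSigma (d : ℕ) (n : ℤ) : MeasurableSpace (Env d) :=
  ⨆ (p : ℤ × Site d) (_ : p.1 ≤ n), MeasurableSpace.comap (fun ω : Env d => ω p) inferInstance

/-- The σ-algebra generated by `ω_{m,x}` with `m ≥ n` and arbitrary `x`. -/
abbrev futureSigma (d : ℕ) (n : ℤ) : MeasurableSpace (Env d) :=
  ⨆ (p : ℤ × Site d) (_ : n ≤ p.1), MeasurableSpace.comap (fun ω : Env d => ω p) inferInstance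

/-- The environment is i.i.d. in space and time, and uniformly elliptic. -/
structure IsEllipticIID {d : ℕ} (P : Measure (Env d)) : Prop where
  indep : iIndepFun (fun (p : ℤ × Site d) (ω : Env d) => ω p) P
  ident : ∀ p : ℤ × Site d, P.map (fun ω => ω p) = P.map (fun ω => ω 0)
  elliptic : ∃ c : ℝ, 0 < c ∧ ∀ z : Step d, ∀ᵐ ω ∂P, c ≤ (ω 0).1 z

/-- Sequences of steps. The value `z i` is the step `Z_{i+1} = X_{i+1} - X_i`, so that such sequences
correspond bijectively to nearest-neighbour paths `(X_n)` with `X_0 = 0`. -/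
abbrev Steps (d : ℕ) : Type := ℕ → Step d

/-- The position `X_n` of the walk started at the origin. -/
def pos {d : ℕ} (z : Steps d) (n : ℕ) : Site d := ∑ i ∈ Finset.range n, (z i).1

/-- The probability measure on `U` with the given weights. -/
def stepMeasure {d : ℕ} (p : SiteEnv d) : Measure (Step d) :=
  ∑ z : Step d, ENNReal.ofReal (p.1 z) • Measure.dirac z

instance instIsProbabilityMeasureStepMeasure {d : ℕ} (p : SiteEnv d) :
    IsProbabilityMeasure (stepMeasure p) := by
  constructor
  simp only [stepMeasure, Measure.coe_finsetSum, Finset.sum_apply, Measure.smul_apply,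
    measure_univ, smul_eq_mul, mul_one]
  rw [← ENNReal.ofReal_sum_of_nonneg (fun z _ => p.2.1 z), p.2.2, ENNReal.ofReal_one]

/-- The position `X_{n+1} = Z_1 + ⋯ + Z_{n+1}` reached by the first `n + 1` steps. -/
def histPos {d n : ℕ} (h : (_ : Finset.Iic n) → Step d) : Site d := ∑ i, (h i).1

/-- Given the first `n + 1` steps, the next step, which is made at time `n + 1`, is chosen according
to the environment at the current space-time point. -/
def stepKernel {d : ℕ} (ω : Env d) (n : ℕ) :
    Kernel ((_ : Finset.Iic n) → Step d) (Step d) :=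
  Kernel.ofFunOfCountable fun h => stepMeasure (ω ((n : ℤ) + 1, histPos h))

instance instIsMarkovKernelStepKernel {d : ℕ} (ω : Env d) (n : ℕ) :
    IsMarkovKernel (stepKernel ω n) :=
  ⟨fun h => instIsProbabilityMeasureStepMeasure (ω ((n : ℤ) + 1, histPos h))⟩

/-- The quenched law `P_{0,0}^ω` of the walk started at the origin at time `0`, as a law on step
sequences: the first step has law `ω_{0,0}`, and the later ones follow the kernels above. -/
def quenchedLaw {d : ℕ} (ω : Env d) : Measure (Steps d) :=
  ∑ z : Step d, ENNReal.ofReal ((ω 0).1 z) •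
    Kernel.traj (X := fun _ => Step d) (stepKernel ω) 0 (fun _ => z)

/-- Expectation `E_{0,0}` under the averaged law, the semi-direct product of `P` and `P_{0,0}^ω`. -/
def averagedExp {d : ℕ} (P : Measure (Env d)) (F : Env d → Steps d → ℝ) : ℝ :=
  ∫ ω, ∫ z, F ω z ∂(quenchedLaw ω) ∂P

/-- The embedding of `ℤ^d` in the Euclidean space `ℝ^d`. -/
def toE {d : ℕ} (x : Site d) : EuclideanSpace ℝ (Fin d) := WithLp.toLp 2 fun i => (x i : ℝ)

/-- The mean velocity `X_n / n`. -/
def velocity {d : ℕ} (z : Steps d) (n : ℕ) : EuclideanSpace ℝ (Fin d) :=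
  (n : ℝ)⁻¹ • toE (pos z n)

/-- The set `𝒟` of `ξ ∈ ℝ^d` with `|ξ₁| + ⋯ + |ξ_d| ≤ 1`. -/
def velocityDomain (d : ℕ) : Set (EuclideanSpace ℝ (Fin d)) := {ξ | ∑ i, |ξ i| ≤ 1}

/-- The averaged transition vector `q(z) = 𝔼[π_{0,1}(0, z)]`. -/
def meanStep {d : ℕ} (P : Measure (Env d)) (z : Step d) : ℝ := ∫ ω, (ω 0).1 z ∂P

/-- `Λ_c(θ) = log (∑_{z ∈ U} q(z) e^{⟨θ, z⟩})`. -/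
def logMGF {d : ℕ} (P : Measure (Env d)) (θ : EuclideanSpace ℝ (Fin d)) : ℝ :=
  Real.log (∑ z : Step d, meanStep P z * Real.exp (inner ℝ θ (toE z.1)))

/-- The averaged rate function `I_c`, the convex conjugate of `Λ_c`. -/
def averagedRate {d : ℕ} (P : Measure (Env d)) (ξ : EuclideanSpace ℝ (Fin d)) : EReal :=
  ⨆ θ : EuclideanSpace ℝ (Fin d), ((inner ℝ θ ξ - logMGF P θ : ℝ) : EReal)

/-- `(1/n) log p`, with `log 0 = -∞`. -/
def scaledLog (n : ℕ) (p : ℝ≥0∞) : EReal := (((n : ℝ)⁻¹ : ℝ) : EReal) * ENNReal.log p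

/-- The quenched large deviation principle for the mean velocity holds in a neighbourhood of `ξ`,
with a deterministic rate function whose value at `ξ` is `I_c(ξ)`. -/
def QuenchedLDPNear {d : ℕ} (P : Measure (Env d)) (ξ : EuclideanSpace ℝ (Fin d)) : Prop :=
  ∃ (η : ℝ) (I : EuclideanSpace ℝ (Fin d) → ℝ≥0∞), 0 < η ∧
    LowerSemicontinuousOn I (Metric.ball ξ η) ∧
    ((I ξ : ℝ≥0∞) : EReal) = averagedRate P ξ ∧
    ∀ᵐ ω ∂P, ∀ G : Set (EuclideanSpace ℝ (Fin d)), MeasurableSet G →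
      closure G ⊆ Metric.ball ξ η →
      -((⨅ x ∈ interior G, I x : ℝ≥0∞) : EReal) ≤
          liminf (fun n : ℕ => scaledLog n (quenchedLaw ω {z | velocity z n ∈ G})) atTop ∧
        limsup (fun n : ℕ => scaledLog n (quenchedLaw ω {z | velocity z n ∈ G})) atTop ≤
          -((⨅ x ∈ closure G, I x : ℝ≥0∞) : EReal)

/-- Test functions: `f` is bounded, depends on the steps only through the first `K` of them, and for
fixed steps is measurable with respect to `ℬ_{-N}^+ ∩ ℬ_M^-`. -/
structure IsLocalTest {d : ℕ} (N M K : ℕ) (f : Env d × Steps d → ℝ) : Prop where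
  bounded : ∃ C : ℝ, ∀ p, |f p| ≤ C
  steps : ∀ (ω : Env d) (z z' : Steps d), (∀ i < K, z i = z' i) → f (ω, z) = f (ω, z')
  env : ∀ z : Steps d,
    Measurable[futureSigma d (-(N : ℤ)) ⊓ pastSigma d (M : ℤ)] (fun ω : Env d => f (ω, z))

/-- The point `(T_{j,X_j} ω, (Z_{j+i})_{i ≥ 1})` of `Ω × U^ℕ`. -/
def seenFrom {d : ℕ} (ω : Env d) (z : Steps d) (j : ℕ) : Env d × Steps d :=
  (shift (j : ℤ) (pos z j) ω, fun i => z (j + i))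

/-- The empirical process `(1/n) ∑_{j<n} δ_{(T_{j,X_j} ω, (Z_{j+i})_{i ≥ 1})}` of the environment
Markov chain. -/
def empiricalProcess {d : ℕ} (ω : Env d) (z : Steps d) (n : ℕ) : Measure (Env d × Steps d) :=
  (n : ℝ≥0∞)⁻¹ • ∑ j ∈ Finset.range n, Measure.dirac (seenFrom ω z j)

/-- The defining property of the measure `μ̄_ξ^∞` on `Ω × U^ℕ`. -/
def IsTiltedLaw {d : ℕ} (P : Measure (Env d)) (ξ : EuclideanSpace ℝ (Fin d))
    (μ : Measure (Env d × Steps d)) : Prop :=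
  ∃ θ : EuclideanSpace ℝ (Fin d), HasGradientAt (logMGF P) ξ θ ∧
    ∀ (N M K : ℕ) (f : Env d × Steps d → ℝ), IsLocalTest N M K f →
      ∫ p, f p ∂μ = averagedExp P fun ω z =>
        Real.exp (inner ℝ θ (toE (pos z (N + M + K + 1)))
            - ((N + M + K + 1 : ℕ) : ℝ) * logMGF P θ) * f (seenFrom ω z N)

end

end SpaceTimeRWRE

open SpaceTimeRWRE

namespace SpaceTimeRWRE

noncomputable section

/-! The walk never meets the same time slice of the environment twice. A cell is a time slice seen
from the walker together with the step taken. Tilt the averaged law by `exp(⟨θ, X_n⟩ - n Λ_c(θ))`: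
slices at different times are independent and translation invariant, so the first `n` cells become
i.i.d. (`IsEllipticIID.averagedExp_cells`). A local test function seen from the walker is a function
of `N + M + K + 1` consecutive cells (`IsLocalTest.seenFrom_eq_windowFun`). The limit measure is
therefore the image `tiltedLaw` of a two-sided i.i.d. sequence of cells. It is the only candidate,
because `Λ_c` is strictly convex and local functions determine a measure (`ext_of_localTests`).

Averages over windows of an i.i.d. sequence concentrate exponentially (`abs_window_sum_tail`).
Markov's inequality and Borel–Cantelli carry this from the averaged to the quenched tilted
expectation (`IsEllipticIID.ae_tiltedDeviation_le`): almost surely, deviations cost `exp(-γn)` under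
the tilt.

If `∇Λ_c(θ) = ξ`, then on `|X_n/n - ξ| ≤ δ` the tilt is at least `exp(n(I_c(ξ) - ‖θ‖δ))` up to a
constant factor. Removing it bounds the quenched probability of deviating with velocity near `ξ` by
`exp(-n(I_c(ξ) + γ - ‖θ‖δ))` (`IsLocalTest.measureReal_deviation_le`). The quenched lower bound says
that the conditioning event has probability at least `exp(-n(I_c(ξ) + γ/4))`. Since the two rates
agree at `ξ`, the quotient decays exponentially for small `δ`. -/

/-! ### Quenched probabilities of finite paths. -/

theorem histPos_frestrictLe {d : ℕ} (z : Steps d) (n : ℕ) :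
    histPos (Preorder.frestrictLe (π := fun _ => Step d) n z) = pos z (n + 1) := by
  unfold histPos pos
  rw [show (∑ i : Finset.Iic n, (Preorder.frestrictLe (π := fun _ => Step d) n z i).1)
      = ∑ i : Finset.Iic n, (z i).1 from rfl, Finset.sum_coe_sort (Finset.Iic n) fun i => (z i).1]
  congr 1
  ext; simp

theorem stepMeasure_singleton {d : ℕ} (p : SiteEnv d) (z : Step d) :
    stepMeasure p {z} = ENNReal.ofReal (p.1 z) := by
  classical
  simp only [stepMeasure, Measure.coe_finsetSum, Finset.sum_apply, Measure.smul_apply,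
    smul_eq_mul, Measure.dirac_apply' _ (measurableSet_singleton z)]
  rw [Finset.sum_eq_single z] <;> simp +contextual [Set.indicator]

/-- The factor for time `0` is absent because the trajectory starts from a prescribed first step;
the mixture in `quenchedLaw` supplies it. The induction disintegrates the law of the first `n + 2`
steps over that of the first `n + 1`. -/
theorem traj_cylinder {d : ℕ} (ω : Env d) (z₀ : Step d) (z : Steps d) (n : ℕ) :
    Kernel.traj (X := fun _ => Step d) (stepKernel ω) 0 (fun _ => z₀) {x | ∀ i < n + 1, x i = z i}
      = ({z 0} : Set (Step d)).indicator (fun _ => ENNReal.ofReal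
        (∏ i ∈ Finset.range n, (ω ((i : ℤ) + 1, pos z (i + 1))).1 (z (i + 1)))) z₀ := by
  classical
  induction n with
  | zero =>
    have h := Kernel.traj_map_frestrictLe_apply (X := fun _ => Step d) (κ := stepKernel ω) 0 0
      (fun _ => z₀)
    rw [Kernel.partialTraj_self, Kernel.id_apply] at h
    have hs : {x : Steps d | ∀ i < 0 + 1, x i = z i} =
        Preorder.frestrictLe (π := fun _ => Step d) 0 ⁻¹' {y | y ⟨0, by simp⟩ = z 0} := by
      ext; simp
    have hm : MeasurableSet {y : (i : Finset.Iic 0) → Step d | y ⟨0, by simp⟩ = z 0} :=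
      measurable_pi_apply _ (measurableSet_singleton _)
    rw [hs, ← Measure.map_apply (Preorder.measurable_frestrictLe 0) hm, h, Measure.dirac_apply' _ hm]
    simp [Set.indicator]
  | succ n ih =>
    have h := Kernel.partialTraj_compProd_eq_map_traj (X := fun _ => Step d) (κ := stepKernel ω)
      (Nat.zero_le n) (x₀ := fun _ => z₀)
    have hs : {x : Steps d | ∀ i < n + 1 + 1, x i = z i} =
        (fun x : Steps d => (Preorder.frestrictLe (π := fun _ => Step d) n x, x (n + 1))) ⁻¹'
          ({Preorder.frestrictLe (π := fun _ => Step d) n z} ×ˢ {z (n + 1)}) := by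
      ext x
      simp only [Set.mem_ofPred_eq, Set.mem_preimage, Set.mem_prod, Set.mem_singleton_iff,
        funext_iff, Preorder.frestrictLe_apply, Subtype.forall, Finset.mem_Iic]
      constructor
      · exact fun h => ⟨fun i hi => h i (by omega), h _ (by omega)⟩
      · intro h i hi
        rcases Nat.lt_or_ge i (n + 1) with h' | h'
        · exact h.1 i (by omega)
        · obtain rfl : i = n + 1 := by omega
          exact h.2
    have hs' : {x : Steps d | ∀ i < n + 1, x i = z i} =
        Preorder.frestrictLe (π := fun _ => Step d) n ⁻¹'
          {Preorder.frestrictLe (π := fun _ => Step d) n z} := by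
      ext x
      simp [funext_iff]
    rw [hs, ← Measure.map_apply (by fun_prop) (MeasurableSet.prod (measurableSet_singleton _)
      (measurableSet_singleton _)), ← h, Measure.compProd_apply_prod (measurableSet_singleton _)
      (measurableSet_singleton _), Measure.restrict_singleton, lintegral_smul_measure,
      lintegral_dirac, ← Kernel.traj_map_frestrictLe_apply, Measure.map_apply (by fun_prop)
      (measurableSet_singleton _), ← hs', ih]
    have hk : stepKernel ω n (Preorder.frestrictLe (π := fun _ => Step d) n z) {z (n + 1)}
        = ENNReal.ofReal ((ω ((n : ℤ) + 1, pos z (n + 1))).1 (z (n + 1))) := by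
      rw [← histPos_frestrictLe]
      exact stepMeasure_singleton _ _
    rw [hk, Finset.prod_range_succ, smul_eq_mul]
    by_cases hz : z₀ = z 0
    · simp only [hz, Set.mem_singleton_iff, Set.indicator_of_mem]
      rw [ENNReal.ofReal_mul (Finset.prod_nonneg fun i _ => (ω _).2.1 _)]
    · simp [hz]

instance instIsProbabilityMeasureQuenchedLaw {d : ℕ} (ω : Env d) :
    IsProbabilityMeasure (quenchedLaw ω) := by
  constructor
  simp only [quenchedLaw, Measure.coe_finsetSum, Finset.sum_apply, Measure.smul_apply,
    measure_univ, smul_eq_mul, mul_one]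
  rw [← ENNReal.ofReal_sum_of_nonneg (fun z _ => (ω 0).2.1 z), (ω 0).2.2, ENNReal.ofReal_one]

/-- The quenched probability that the first `n` steps are those of `z`. -/
def pathWeight {d : ℕ} (ω : Env d) (z : Steps d) (n : ℕ) : ℝ :=
  ∏ i ∈ Finset.range n, (ω ((i : ℤ), pos z i)).1 (z i)

theorem pathWeight_nonneg {d : ℕ} (ω : Env d) (z : Steps d) (n : ℕ) : 0 ≤ pathWeight ω z n :=
  Finset.prod_nonneg fun _ _ => (ω _).2.1 _

theorem quenchedLaw_cylinder {d : ℕ} (ω : Env d) (z : Steps d) (n : ℕ) :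
    quenchedLaw ω {x | ∀ i < n, x i = z i} = ENNReal.ofReal (pathWeight ω z n) := by
  classical
  rcases n with _ | n
  · simp [pathWeight]
  · simp only [quenchedLaw, Measure.coe_finsetSum, Finset.sum_apply, Measure.smul_apply,
      smul_eq_mul, traj_cylinder]
    rw [Finset.sum_eq_single (z 0)]
    · rw [Set.indicator_of_mem (Set.mem_singleton _), pathWeight, Finset.prod_range_succ',
        ← ENNReal.ofReal_mul ((ω 0).2.1 _), mul_comm]
      simp [pos]
      rfl
    · intro b _ hb
      simp [hb]
    · simp

/-- The step sequence that starts with `a` and then repeats `z₀`. -/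
def extendSteps {d n : ℕ} (z₀ : Step d) (a : Fin n → Step d) : Steps d :=
  fun i => if h : i < n then a ⟨i, h⟩ else z₀

theorem extendSteps_apply {d n : ℕ} (z₀ : Step d) (a : Fin n → Step d) (i : Fin n) :
    extendSteps z₀ a i = a i := by simp [extendSteps]

/-- The padding step `z₀` is immaterial: the path weight up to `n` reads only the first `n` steps.
-/
theorem quenchedLaw_map_fin {d : ℕ} (ω : Env d) (z₀ : Step d) (n : ℕ) :
    (quenchedLaw ω).map (fun x (i : Fin n) => x i) =
      ∑ a : Fin n → Step d, ENNReal.ofReal (pathWeight ω (extendSteps z₀ a) n) •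
        Measure.dirac a := by
  classical
  have hm : Measurable fun (x : Steps d) (i : Fin n) => x i := by fun_prop
  refine Measure.ext_of_singleton fun a => ?_
  rw [Measure.map_apply hm (measurableSet_singleton _)]
  have : (fun (x : Steps d) (i : Fin n) => x i) ⁻¹' {a} =
      {x | ∀ i < n, x i = extendSteps z₀ a i} := by
    ext x
    simp only [Set.mem_preimage, Set.mem_singleton_iff, funext_iff, Set.mem_ofPred_eq]
    exact ⟨fun h i hi => by simpa [extendSteps, hi] using h ⟨i, hi⟩,
      fun h i => by simpa [extendSteps] using h i i.2⟩
  rw [this, quenchedLaw_cylinder]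
  simp only [Measure.coe_finsetSum, Finset.sum_apply, Measure.smul_apply, smul_eq_mul,
    Measure.dirac_apply' _ (measurableSet_singleton a)]
  rw [Finset.sum_eq_single a] <;> simp +contextual [Set.indicator]

/-- Quenched expectations of functions of the first `n` steps are finite sums. -/
theorem integral_quenchedLaw {d : ℕ} (ω : Env d) (z₀ : Step d) (n : ℕ) (F : Steps d → ℝ)
    (hF : ∀ x y : Steps d, (∀ i < n, x i = y i) → F x = F y) :
    ∫ x, F x ∂(quenchedLaw ω) = ∑ a : Fin n → Step d,
      pathWeight ω (extendSteps z₀ a) n * F (extendSteps z₀ a) := by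
  have hm : Measurable fun (x : Steps d) (i : Fin n) => x i := by fun_prop
  have h1 : ∀ x : Steps d, F x = F (extendSteps z₀ fun i : Fin n => x i) := fun x =>
    hF _ _ fun i hi => by simp [extendSteps, hi]
  have h2 : Measurable fun a : Fin n → Step d => F (extendSteps z₀ a) := measurable_of_countable _
  calc ∫ x, F x ∂(quenchedLaw ω)
      = ∫ x, F (extendSteps z₀ fun i : Fin n => x i) ∂(quenchedLaw ω) := by simp_rw [← h1]
    _ = ∫ a, F (extendSteps z₀ a) ∂((quenchedLaw ω).map (fun x (i : Fin n) => x i)) :=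
        (integral_map hm.aemeasurable h2.aestronglyMeasurable).symm
    _ = _ := by
      rw [quenchedLaw_map_fin ω z₀, integral_finsetSum_measure]
      · refine Finset.sum_congr rfl fun a _ => ?_
        rw [integral_smul_measure, integral_dirac, ENNReal.toReal_ofReal (pathWeight_nonneg _ _ _),
          smul_eq_mul]
      · intro a _
        exact (integrable_dirac (by simp)).smul_measure (by simp)

/-! ### The i.i.d. structure of the cells under the tilt. -/

/-- The environment at one time. -/
abbrev Slice (d : ℕ) : Type := Site d → SiteEnv d

/-- The environment at one time, seen from the walker, together with the step of the walker. -/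
abbrev Cell (d : ℕ) : Type := Slice d × Step d

/-- The cells visited by the walk. -/
def cells {d : ℕ} (ω : Env d) (z : Steps d) (j : ℕ) : Cell d :=
  (fun x => ω ((j : ℤ), x + pos z j), z j)

/-- The law of the environment at one space-time point. -/
def siteLaw {d : ℕ} (P : Measure (Env d)) : Measure (SiteEnv d) := P.map fun ω => ω 0

instance instIsProbabilityMeasureSiteLaw {d : ℕ} (P : Measure (Env d)) [IsProbabilityMeasure P] :
    IsProbabilityMeasure (siteLaw P) :=
  Measure.isProbabilityMeasure_map (measurable_pi_apply _).aemeasurable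

/-- The law of the environment at one time. -/
def sliceLaw {d : ℕ} (P : Measure (Env d)) [IsProbabilityMeasure P] : Measure (Slice d) :=
  Measure.infinitePi fun _ => siteLaw P

instance instIsProbabilityMeasureSliceLaw {d : ℕ} (P : Measure (Env d)) [IsProbabilityMeasure P] :
    IsProbabilityMeasure (sliceLaw P) := by unfold sliceLaw; infer_instance

/-- The exponentially tilted weight of the step `z` from the origin in the slice `s`. -/
def cellDensity {d : ℕ} (P : Measure (Env d)) (θ : EuclideanSpace ℝ (Fin d)) (z : Step d)
    (s : Slice d) : ℝ :=
  Real.exp (inner ℝ θ (toE z.1) - logMGF P θ) * (s 0).1 z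

/-- The law of a cell under the exponential tilt. -/
def cellLaw {d : ℕ} (P : Measure (Env d)) [IsProbabilityMeasure P]
    (θ : EuclideanSpace ℝ (Fin d)) : Measure (Cell d) :=
  ∑ z : Step d, ((sliceLaw P).withDensity fun s => ENNReal.ofReal (cellDensity P θ z s)).map
    fun s => (s, z)

section

variable {d : ℕ} {P : Measure (Env d)}

theorem IsEllipticIID.eq_infinitePi (hP : IsEllipticIID P) :
    P = Measure.infinitePi fun _ => siteLaw P := by
  have h := hP.indep.map_fun_eq_infinitePi_map fun p => measurable_pi_apply p
  rw [show (fun (ω : Env d) p => ω p) = id from rfl, Measure.map_id] at h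
  rw [h]
  congr 1
  funext p
  rw [hP.ident p, ← h]
  rfl

/-- For fixed shifts `y`, the space-time points `(i, x + y i)` are distinct for distinct `(i, x)`,
so reading `ω` there gives independent copies of `siteLaw P`. The walker's positions are random, but
they may be treated as fixed shifts once the path is fixed. -/
theorem IsEllipticIID.map_slices [IsProbabilityMeasure P] (hP : IsEllipticIID P) {n : ℕ} (y : Fin n → Site d) :
    P.map (fun ω (i : Fin n) (x : Site d) => ω ((i : ℤ), x + y i)) =
      Measure.infinitePi fun _ => sliceLaw P := by
  have hinj : Function.Injective fun p : Fin n × Site d => (((p.1 : ℕ) : ℤ), p.2 + y p.1) := by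
    rintro ⟨i, x⟩ ⟨j, x'⟩ h
    simp only [Prod.mk.injEq, Nat.cast_inj, Fin.val_inj] at h
    obtain ⟨rfl, h⟩ := h
    simpa using h
  have h1 := Measure.map_infinitePi_infinitePi_of_inj (P := fun _ => siteLaw P) hinj
  have h2 := Measure.infinitePi_map_curry fun (_ : Fin n) (_ : Site d) => siteLaw P
  rw [← hP.eq_infinitePi] at h1
  rw [← h1, Measure.map_map (by fun_prop) (by fun_prop)] at h2
  exact h2

theorem measurable_weight (z : Step d) : Measurable fun p : SiteEnv d => p.1 z :=
  (measurable_pi_apply z).comp measurable_subtype_coe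

theorem weight_le_one (p : SiteEnv d) (z : Step d) : p.1 z ≤ 1 :=
  (Finset.single_le_sum (fun z _ => p.2.1 z) (Finset.mem_univ z)).trans_eq p.2.2

theorem cellDensity_nonneg (θ : EuclideanSpace ℝ (Fin d)) (z : Step d) (s : Slice d) :
    0 ≤ cellDensity P θ z s := mul_nonneg (Real.exp_pos _).le ((s 0).2.1 z)

theorem measurable_cellDensity (θ : EuclideanSpace ℝ (Fin d)) (z : Step d) :
    Measurable (cellDensity P θ z) := by
  unfold cellDensity
  exact ((measurable_weight z).comp (measurable_pi_apply 0)).const_mul _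

theorem integrable_weight [IsProbabilityMeasure P] (z : Step d) : Integrable (fun ω : Env d => (ω 0).1 z) P := by
  refine Integrable.of_bound ((measurable_weight z).comp
    (measurable_pi_apply 0)).aestronglyMeasurable 1 (ae_of_all _ fun ω => ?_)
  rw [Real.norm_of_nonneg ((ω 0).2.1 z)]
  exact weight_le_one _ _

theorem IsEllipticIID.meanStep_pos [IsProbabilityMeasure P] (hP : IsEllipticIID P) (z : Step d) : 0 < meanStep P z := by
  obtain ⟨c, hc, h⟩ := hP.elliptic
  calc 0 < c := hc
    _ = ∫ _ω, c ∂P := by simp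
    _ ≤ _ := integral_mono_ae (integrable_const _) (integrable_weight z) (h z)

/-- A probability vector cannot live on an empty set of steps, so the existence of an environment
already excludes `d = 0`. -/
theorem Env.nonempty_step (ω : Env d) : Nonempty (Step d) := by
  by_contra h
  rw [not_nonempty_iff] at h
  simpa using (ω 0).2.2

theorem IsEllipticIID.mgf_pos [IsProbabilityMeasure P] (hP : IsEllipticIID P) (θ : EuclideanSpace ℝ (Fin d)) :
    0 < ∑ z : Step d, meanStep P z * Real.exp (inner ℝ θ (toE z.1)) := by
  obtain ⟨ω⟩ : Nonempty (Env d) := nonempty_of_isProbabilityMeasure P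
  have := ω.nonempty_step
  exact Finset.sum_pos (fun z _ => mul_pos (hP.meanStep_pos z) (Real.exp_pos _))
    Finset.univ_nonempty

theorem cellLaw_apply [IsProbabilityMeasure P] (θ : EuclideanSpace ℝ (Fin d)) {S : Set (Cell d)} (hS : MeasurableSet S) :
    cellLaw P θ S = ∑ z : Step d, ∫⁻ s, ENNReal.ofReal (cellDensity P θ z s) *
      S.indicator 1 (s, z) ∂sliceLaw P := by
  simp only [cellLaw, Measure.coe_finsetSum, Finset.sum_apply]
  refine Finset.sum_congr rfl fun z _ => ?_
  have hm : Measurable fun s : Slice d => (s, z) := by fun_prop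
  rw [Measure.map_apply hm hS, withDensity_apply _ (hm hS), ← lintegral_indicator (hm hS)]
  refine lintegral_congr fun s => ?_
  by_cases h : (s, z) ∈ S
  · rw [Set.indicator_of_mem (show s ∈ (fun s : Slice d => (s, z)) ⁻¹' S from h),
      Set.indicator_of_mem h, Pi.one_apply, mul_one]
  · rw [Set.indicator_of_notMem (show s ∉ (fun s : Slice d => (s, z)) ⁻¹' S from h),
      Set.indicator_of_notMem h, mul_zero]

theorem integral_sliceLaw_weight [IsProbabilityMeasure P] (z : Step d) :
    ∫⁻ s, ENNReal.ofReal ((s 0).1 z) ∂sliceLaw P = ENNReal.ofReal (meanStep P z) := by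
  have hm : Measurable fun p : SiteEnv d => ENNReal.ofReal (p.1 z) :=
    (measurable_weight z).ennreal_ofReal
  rw [sliceLaw, ← lintegral_map (f := fun p : SiteEnv d => ENNReal.ofReal (p.1 z)) hm
    (measurable_pi_apply 0), Measure.infinitePi_map_eval, siteLaw,
    lintegral_map hm (measurable_pi_apply 0), meanStep,
    ofReal_integral_eq_lintegral_ofReal (integrable_weight z)
      (ae_of_all _ fun ω => (ω 0).2.1 z)]

/-- `Λ_c(θ)` is exactly the normalisation: summing the tilted mean weights over the steps gives the
moment generating function divided by itself. -/
theorem IsEllipticIID.isProbabilityMeasure_cellLaw [IsProbabilityMeasure P] (hP : IsEllipticIID P)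
    (θ : EuclideanSpace ℝ (Fin d)) : IsProbabilityMeasure (cellLaw P θ) := by
  constructor
  rw [cellLaw_apply θ MeasurableSet.univ]
  have h : ∀ z : Step d, ∫⁻ s, ENNReal.ofReal (cellDensity P θ z s) *
      (Set.univ : Set (Cell d)).indicator 1 (s, z) ∂sliceLaw P =
      ENNReal.ofReal (Real.exp (inner ℝ θ (toE z.1) - logMGF P θ) * meanStep P z) := by
    intro z
    simp only [Set.indicator_univ, Pi.one_apply, mul_one, cellDensity]
    simp_rw [ENNReal.ofReal_mul (Real.exp_pos _).le]
    have hm : Measurable fun s : Slice d => ENNReal.ofReal ((s 0).1 z) :=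
      ((measurable_weight z).comp (measurable_pi_apply 0)).ennreal_ofReal
    rw [lintegral_const_mul _ hm, integral_sliceLaw_weight]
  rw [Finset.sum_congr rfl fun z _ => h z, ← ENNReal.ofReal_sum_of_nonneg fun z _ =>
    mul_nonneg (Real.exp_pos _).le (hP.meanStep_pos z).le]
  simp_rw [Real.exp_sub, div_mul_eq_mul_div]
  rw [← Finset.sum_div, logMGF, Real.exp_log (hP.mgf_pos θ),
    Finset.sum_congr rfl fun z _ => mul_comm (Real.exp (inner ℝ θ (toE z.1))) (meanStep P z),
    div_self (hP.mgf_pos θ).ne', ENNReal.ofReal_one]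

theorem measurable_cells (z : Steps d) (j : ℕ) : Measurable fun ω : Env d => cells ω z j := by
  unfold cells; fun_prop

theorem measurable_cells_fin (z : Steps d) (n : ℕ) :
    Measurable fun (ω : Env d) (i : Fin n) => cells ω z i :=
  measurable_pi_lambda _ fun i => measurable_cells z i

/-- The tilted averaged law of the first `n` cells is a product measure. -/
theorem IsEllipticIID.sum_map_cells [IsProbabilityMeasure P] (hP : IsEllipticIID P) (θ : EuclideanSpace ℝ (Fin d))
    (z₀ : Step d) (n : ℕ) :
    ∑ a : Fin n → Step d, (P.withDensity fun ω => ∏ i : Fin n,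
        ENNReal.ofReal (cellDensity P θ (a i) (cells ω (extendSteps z₀ a) i).1)).map
          (fun ω (i : Fin n) => cells ω (extendSteps z₀ a) i) =
      Measure.pi fun _ => cellLaw P θ := by
  classical
  have := hP.isProbabilityMeasure_cellLaw θ
  symm
  refine Measure.pi_eq fun S hS => ?_
  simp only [Measure.coe_finsetSum, Finset.sum_apply, cellLaw_apply θ (hS _)]
  -- Expanding the product of sums over single steps gives a sum over paths `a`, to be matched path
  -- by path.
  rw [Finset.prod_univ_sum, Fintype.piFinset_univ]
  refine Finset.sum_congr rfl fun a _ => ?_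
  set h : Fin n → Slice d → ℝ≥0∞ := fun i s =>
    ENNReal.ofReal (cellDensity P θ (a i) s) * (S i).indicator 1 (s, a i) with hh
  have hhm : ∀ i, Measurable (h i) := fun i =>
    (measurable_cellDensity θ (a i)).ennreal_ofReal.mul
      ((measurable_one.indicator (hS i)).comp (by fun_prop))
  have hm := measurable_cells_fin (extendSteps z₀ a) n
  have hSm : MeasurableSet (Set.univ.pi S) := MeasurableSet.univ_pi hS
  rw [Measure.map_apply hm hSm, withDensity_apply _ (hm hSm), ← lintegral_indicator (hm hSm)]
  have key : ∀ ω : Env d, ((fun ω (i : Fin n) => cells ω (extendSteps z₀ a) i) ⁻¹'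
      (Set.univ.pi S)).indicator (fun ω => ∏ i : Fin n,
        ENNReal.ofReal (cellDensity P θ (a i) (cells ω (extendSteps z₀ a) i).1)) ω =
      ∏ i : Fin n, h i (fun x => ω ((i : ℤ), x + pos (extendSteps z₀ a) i)) := by
    intro ω
    have hc : ∀ i : Fin n, cells ω (extendSteps z₀ a) i =
        (fun x => ω ((i : ℤ), x + pos (extendSteps z₀ a) i), a i) := fun i => by
      simp [cells, extendSteps_apply]
    simp only [hh, Finset.prod_mul_distrib, Set.indicator, Set.mem_preimage, Set.mem_univ_pi, hc,
      Pi.one_apply]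
    by_cases hmem : ∀ i : Fin n, ((fun x => ω ((i : ℤ), x + pos (extendSteps z₀ a) i)), a i) ∈ S i
    · simp [hmem]
    · rw [if_neg hmem]
      push Not at hmem
      obtain ⟨i, hi⟩ := hmem
      refine (mul_eq_zero_of_right _ (Finset.prod_eq_zero (Finset.mem_univ i) ?_)).symm
      rw [if_neg hi]
  simp_rw [key]
  have h1 := hP.map_slices (n := n) fun i => pos (extendSteps z₀ a) i
  have hm2 : Measurable fun (ω : Env d) (i : Fin n) (x : Site d) =>
      ω ((i : ℤ), x + pos (extendSteps z₀ a) i) := by fun_prop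
  have h2 : ∫⁻ ω, ∏ i : Fin n, h i (fun x => ω ((i : ℤ), x + pos (extendSteps z₀ a) i)) ∂P =
      ∫⁻ s : Fin n → Slice d, ∏ i : Fin n, h i (s i) ∂(Measure.infinitePi fun _ => sliceLaw P) := by
    rw [← h1, lintegral_map (by fun_prop) hm2]
  -- With the path fixed, the `i`-th factor depends on the `i`-th slice only, so the integral
  -- factorises.
  rw [h2, lintegral_prod_eq_prod_lintegral_of_indepFun Finset.univ
    (fun i (s : Fin n → Slice d) => h i (s i)) (iIndepFun_infinitePi hhm) (by fun_prop)]
  refine Finset.prod_congr rfl fun i _ => ?_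
  rw [← lintegral_map (f := h i) (hhm i) (measurable_pi_apply i), Measure.infinitePi_map_eval]

theorem inner_toE_pos (θ : EuclideanSpace ℝ (Fin d)) (z : Steps d) (n : ℕ) :
    inner ℝ θ (toE (pos z n)) = ∑ i ∈ Finset.range n, inner ℝ θ (toE (z i).1) := by
  have h : toE (pos z n) = ∑ i ∈ Finset.range n, toE (z i).1 := by
    ext j
    simp [toE, pos]
  rw [h, inner_sum]

theorem prod_cellDensity (θ : EuclideanSpace ℝ (Fin d)) (ω : Env d) (z : Steps d) (n : ℕ) :
    ∏ i : Fin n, cellDensity P θ (z i) (cells ω z i).1 =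
      pathWeight ω z n * Real.exp (inner ℝ θ (toE (pos z n)) - n * logMGF P θ) := by
  rw [Fin.prod_univ_eq_prod_range (fun i => cellDensity P θ (z i) (cells ω z i).1) n]
  simp only [cellDensity, cells, zero_add]
  rw [Finset.prod_mul_distrib, ← Real.exp_sum, Finset.sum_sub_distrib, inner_toE_pos, mul_comm]
  simp [pathWeight]

theorem measurable_pathWeight (z : Steps d) (n : ℕ) :
    Measurable fun ω : Env d => pathWeight ω z n :=
  Finset.measurable_prod _ fun i _ => (measurable_weight (z i)).comp (measurable_pi_apply _)

theorem pathWeight_le_one (ω : Env d) (z : Steps d) (n : ℕ) : pathWeight ω z n ≤ 1 :=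
  Finset.prod_le_one (fun _ _ => (ω _).2.1 _) fun _ _ => weight_le_one _ _

theorem cells_congr_steps (ω : Env d) {z z' : Steps d} {j : ℕ} (h : ∀ i ≤ j, z i = z' i) :
    cells ω z j = cells ω z' j := by
  have hp : pos z j = pos z' j := Finset.sum_congr rfl fun i hi => by
    rw [h i (Finset.mem_range.mp hi).le]
  rw [cells, cells, hp, h j le_rfl]

theorem pos_congr {z z' : Steps d} {n : ℕ} (h : ∀ i < n, z i = z' i) : pos z n = pos z' n :=
  Finset.sum_congr rfl fun i hi => by rw [h i (Finset.mem_range.mp hi)]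

/-- The quenched expectation of a tilted function of the first `n` cells. -/
theorem integral_quenchedLaw_cells (θ : EuclideanSpace ℝ (Fin d)) (z₀ : Step d) {n : ℕ}
    (G : (Fin n → Cell d) → ℝ) (ω : Env d) :
    ∫ z, Real.exp (inner ℝ θ (toE (pos z n)) - n * logMGF P θ) * G (fun i => cells ω z i)
        ∂(quenchedLaw ω) =
      ∑ a : Fin n → Step d, pathWeight ω (extendSteps z₀ a) n *
        (Real.exp (inner ℝ θ (toE (pos (extendSteps z₀ a) n)) - n * logMGF P θ) *
          G (fun i => cells ω (extendSteps z₀ a) i)) := by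
  refine integral_quenchedLaw ω z₀ n _ fun x y h => ?_
  rw [pos_congr h]
  congr 3
  funext i
  exact cells_congr_steps ω fun j hj => h j (by omega)

theorem integrable_pathWeight_mul [IsProbabilityMeasure P] (z : Steps d) {n : ℕ} (c : ℝ)
    {G : (Fin n → Cell d) → ℝ} (hG : Measurable G) {C : ℝ} (hC : ∀ v, |G v| ≤ C) :
    Integrable (fun ω => pathWeight ω z n * (c * G (fun i => cells ω z i))) P := by
  refine Integrable.of_bound (C := 1 * (|c| * C)) ((measurable_pathWeight z n).mul
    ((hG.comp (measurable_cells_fin z n)).const_mul _)).aestronglyMeasurable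
    (ae_of_all _ fun ω => ?_)
  rw [Real.norm_eq_abs, abs_mul, abs_mul, abs_of_nonneg (pathWeight_nonneg _ _ _)]
  gcongr
  · exact pathWeight_le_one _ _ _
  · exact hC _

theorem integrable_quenched_cells [IsProbabilityMeasure P] (θ : EuclideanSpace ℝ (Fin d)) {n : ℕ}
    {G : (Fin n → Cell d) → ℝ} (hG : Measurable G) {C : ℝ} (hC : ∀ v, |G v| ≤ C) :
    Integrable (fun ω => ∫ z, Real.exp (inner ℝ θ (toE (pos z n)) - n * logMGF P θ) *
      G (fun i => cells ω z i) ∂(quenchedLaw ω)) P := by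
  obtain ⟨ω⟩ : Nonempty (Env d) := nonempty_of_isProbabilityMeasure P
  obtain ⟨z₀⟩ := ω.nonempty_step
  simp_rw [integral_quenchedLaw_cells θ z₀ G]
  exact integrable_finsetSum _ fun a _ => integrable_pathWeight_mul _ _ hG hC

/-- Under the tilted averaged law, the cells visited by the walk are i.i.d. -/
theorem IsEllipticIID.averagedExp_cells [IsProbabilityMeasure P] (hP : IsEllipticIID P) (θ : EuclideanSpace ℝ (Fin d))
    {n : ℕ} {G : (Fin n → Cell d) → ℝ} (hG : Measurable G) {C : ℝ} (hC : ∀ v, |G v| ≤ C) :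
    averagedExp P (fun ω z => Real.exp (inner ℝ θ (toE (pos z n)) - n * logMGF P θ) *
      G (fun i => cells ω z i)) = ∫ v, G v ∂(Measure.pi fun _ => cellLaw P θ) := by
  have := hP.isProbabilityMeasure_cellLaw θ
  obtain ⟨ω⟩ : Nonempty (Env d) := nonempty_of_isProbabilityMeasure P
  obtain ⟨z₀⟩ := ω.nonempty_step
  have hsum := hP.sum_map_cells θ z₀ n
  have hint : Integrable G (Measure.pi fun _ : Fin n => cellLaw P θ) :=
    Integrable.of_bound hG.aestronglyMeasurable C (ae_of_all _ hC)
  unfold averagedExp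
  simp_rw [integral_quenchedLaw_cells θ z₀ G]
  rw [integral_finsetSum _ fun a _ => integrable_pathWeight_mul _ _ hG hC, ← hsum,
    integral_finsetSum_measure]
  · refine Finset.sum_congr rfl fun a _ => ?_
    have hD : Measurable fun ω : Env d => ∏ i : Fin n,
        ENNReal.ofReal (cellDensity P θ (a i) (cells ω (extendSteps z₀ a) i).1) :=
      Finset.measurable_prod _ fun i _ => ((measurable_cellDensity θ (a i)).comp
        (measurable_fst.comp (measurable_cells _ _))).ennreal_ofReal
    rw [integral_map (measurable_cells_fin _ n).aemeasurable hG.aestronglyMeasurable,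
      integral_withDensity_eq_integral_toReal_smul hD (ae_of_all _ fun ω =>
        ENNReal.prod_lt_top fun i _ => ENNReal.ofReal_lt_top)]
    refine integral_congr_ae (ae_of_all _ fun ω => ?_)
    have h := prod_cellDensity (P := P) θ ω (extendSteps z₀ a) n
    simp only [extendSteps_apply] at h
    simp only [ENNReal.toReal_prod, ENNReal.toReal_ofReal (cellDensity_nonneg _ _ _), h,
      smul_eq_mul]
    ring
  · intro a ha
    -- Each path contributes a measure dominated by the whole sum, which is the product probability
    -- measure.
    refine hint.mono_measure ?_
    rw [← hsum]
    exact Finset.single_le_sum (f := fun a : Fin n → Step d => (P.withDensity fun ω => ∏ i : Fin n,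
        ENNReal.ofReal (cellDensity P θ (a i) (cells ω (extendSteps z₀ a) i).1)).map
          (fun ω (i : Fin n) => cells ω (extendSteps z₀ a) i)) (fun _ _ => Measure.zero_le _) ha

end

/-! ### Local functions as functions of windows of cells, and the tilted law. -/

section

variable {d : ℕ}

/-- The position at time `i` of the two-sided path through the origin at time `0` whose steps are
recorded in `w`. -/
def displacement (w : ℤ → Cell d) (i : ℤ) : Site d :=
  ∑ k ∈ Finset.Ico 0 i, (w k).2.1 - ∑ k ∈ Finset.Ico i 0, (w k).2.1

/-- The environment and the steps encoded by a two-sided sequence of cells. -/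
def reconstruct (w : ℤ → Cell d) : Env d × Steps d :=
  (fun p => (w p.1).1 (p.2 - displacement w p.1), fun i => (w i).2)

theorem displacement_zero (w : ℤ → Cell d) : displacement w 0 = 0 := by simp [displacement]

theorem displacement_add_one (w : ℤ → Cell d) (k : ℤ) :
    displacement w (k + 1) = displacement w k + (w k).2.1 := by
  unfold displacement
  rcases le_or_gt 0 k with hk | hk
  · have h1 : Finset.Ico 0 (k + 1) = insert k (Finset.Ico 0 k) := by
      ext; simp only [Finset.mem_Ico, Finset.mem_insert]; omega
    rw [h1, Finset.sum_insert (by simp), Finset.Ico_eq_empty (a := k + 1) (by omega),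
      Finset.Ico_eq_empty (a := k) (b := 0) (by omega)]
    simp [add_comm]
  · have h1 : Finset.Ico k 0 = insert k (Finset.Ico (k + 1) 0) := by
      ext; simp only [Finset.mem_Ico, Finset.mem_insert]; omega
    rw [h1, Finset.sum_insert (by simp), Finset.Ico_eq_empty (b := k + 1) (by omega),
      Finset.Ico_eq_empty (a := 0) (b := k) (by omega)]
    simp

theorem displacement_congr {w w' : ℤ → Cell d} {i : ℤ}
    (h : ∀ k, min i 0 ≤ k → k ≤ max i 0 → w k = w' k) : displacement w i = displacement w' i := by
  unfold displacement
  congr 1 <;> refine Finset.sum_congr rfl fun k hk => ?_ <;> rw [Finset.mem_Ico] at hk <;>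
    rw [h k (by omega) (by omega)]

theorem measurable_displacement (i : ℤ) :
    Measurable fun w : ℤ → Cell d => displacement w i := by
  unfold displacement
  refine (Finset.measurable_sum _ fun k _ => ?_).sub (Finset.measurable_sum _ fun k _ => ?_) <;>
  exact measurable_subtype_coe.comp (measurable_snd.comp (measurable_pi_apply k))

/-- Evaluating a slice at a random site is measurable because the displacement takes countably many
values. -/
theorem measurable_reconstruct : Measurable (reconstruct (d := d)) := by
  refine Measurable.prodMk (measurable_pi_lambda _ fun p => ?_) (by fun_prop)
  have h : Measurable fun q : Slice d × Site d => q.1 (p.2 - q.2) :=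
    measurable_from_prod_countable_left fun y => measurable_pi_apply (p.2 - y)
  exact h.comp ((measurable_fst.comp (measurable_pi_apply p.1)).prodMk
    (measurable_displacement p.1))

/-- The σ-algebra is contained in the one generated by restriction to `S`, and a function measurable
for the latter factors through that restriction. -/
theorem eq_of_measurable_iSup_comap {S : Set (ℤ × Site d)} {g : Env d → ℝ}
    (hg : Measurable[⨆ (p : ℤ × Site d) (_ : p ∈ S),
      MeasurableSpace.comap (fun ω : Env d => ω p) inferInstance] g)
    {ω ω' : Env d} (h : ∀ p ∈ S, ω p = ω' p) : g ω = g ω' := by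
  let r : Env d → (S → SiteEnv d) := fun ω p => ω p
  have hle : (⨆ (p : ℤ × Site d) (_ : p ∈ S),
      MeasurableSpace.comap (fun ω : Env d => ω p) inferInstance) ≤
      MeasurableSpace.comap r inferInstance := by
    refine iSup₂_le fun p hp => ?_
    have h1 : (fun ω : Env d => ω p) = (fun v : S → SiteEnv d => v ⟨p, hp⟩) ∘ r := rfl
    rw [h1, ← MeasurableSpace.comap_comp]
    exact MeasurableSpace.comap_mono (measurable_pi_apply _).comap_le
  have hg' : Measurable[MeasurableSpace.comap r inferInstance] g := hg.mono hle le_rfl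
  exact hg'.factorsThrough (funext fun p => h p p.2)

theorem futureSigma_le (n : ℤ) : futureSigma d n ≤ MeasurableSpace.pi :=
  iSup₂_le fun p _ => (measurable_pi_apply p).comap_le

variable {N M K : ℕ} {f : Env d × Steps d → ℝ}

theorem IsLocalTest.congr (hf : IsLocalTest N M K f) {ω ω' : Env d} {z z' : Steps d}
    (hω : ∀ p : ℤ × Site d, -(N : ℤ) ≤ p.1 → p.1 ≤ M → ω p = ω' p)
    (hz : ∀ i < K, z i = z' i) : f (ω, z) = f (ω', z') := by
  rw [hf.steps ω z z' hz]
  -- Measurability is given for the future and the past separately, so `ω` and `ω'` are joined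
  -- through a hybrid: `ω''` agrees with `ω` from time `-N` on, and with `ω'` up to time `M`.
  let ω'' : Env d := fun p => if -(N : ℤ) ≤ p.1 then ω p else ω' p
  have h1 : f (ω, z') = f (ω'', z') :=
    eq_of_measurable_iSup_comap (S := {p | -(N : ℤ) ≤ p.1}) ((hf.env z').mono inf_le_left le_rfl)
      fun p hp => (if_pos (c := -(N : ℤ) ≤ p.1) hp).symm
  have h2 : f (ω'', z') = f (ω', z') := by
    refine eq_of_measurable_iSup_comap (S := {p | p.1 ≤ (M : ℤ)})
      ((hf.env z').mono inf_le_right le_rfl) fun p hp => ?_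
    by_cases h : -(N : ℤ) ≤ p.1
    · exact (if_pos h).trans (hω p h hp)
    · exact if_neg h
  rw [h1, h2]

theorem IsLocalTest.measurable (hf : IsLocalTest N M K f) : Measurable f := by
  rcases isEmpty_or_nonempty (Step d) with h | ⟨⟨z₀⟩⟩
  · have : IsEmpty (Env d × Steps d) := ⟨fun p => h.false (p.2 0)⟩
    exact measurable_of_empty f
  · have h1 : Measurable fun q : Env d × (Fin K → Step d) => f (q.1, extendSteps z₀ q.2) :=
      measurable_from_prod_countable_left fun a =>
        (hf.env (extendSteps z₀ a)).mono (inf_le_left.trans (futureSigma_le _)) le_rfl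
    have h2 : f = (fun q : Env d × (Fin K → Step d) => f (q.1, extendSteps z₀ q.2)) ∘
        fun p => (p.1, fun i : Fin K => p.2 i) := by
      funext p
      exact hf.steps _ _ _ fun i hi => by simp [extendSteps, hi]
    rw [h2]
    exact h1.comp (by fun_prop)

/-- A two-sided sequence of cells extending the window `v`, which starts at time `-N`. -/
def fromWindow {n : ℕ} (N : ℕ) (v : Fin (n + 1) → Cell d) : ℤ → Cell d :=
  fun j => v ⟨min (j + N).toNat n, by omega⟩

/-- A local test function as a function of a window of cells. -/
def windowFun (N M K : ℕ) (f : Env d × Steps d → ℝ) (v : Fin (N + M + K + 1) → Cell d) : ℝ :=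
  f (reconstruct (fromWindow N v))

theorem IsLocalTest.measurable_windowFun (hf : IsLocalTest N M K f) :
    Measurable (windowFun N M K f) := by
  refine (hf.measurable.comp measurable_reconstruct).comp (measurable_pi_lambda _ fun j => ?_)
  exact measurable_pi_apply _

theorem IsLocalTest.reconstruct_eq_windowFun (hf : IsLocalTest N M K f) (w : ℤ → Cell d) :
    f (reconstruct w) = windowFun N M K f fun i => w ((i : ℤ) - N) := by
  -- The truncation in `fromWindow` is inactive at these times, and they suffice: the environment is
  -- read on `[-N, M]`, the steps on `[0, K)`, and the displacements involve only cells between time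
  -- `0` and the time being read.
  have h : ∀ k : ℤ, -(N : ℤ) ≤ k → k ≤ M + K →
      w k = fromWindow N (fun i : Fin (N + M + K + 1) => w ((i : ℤ) - N)) k := by
    intro k h1 h2
    simp only [fromWindow]
    congr 1
    omega
  refine hf.congr (fun p h1 h2 => ?_) fun i hi => ?_
  · rw [h p.1 h1 (by omega), displacement_congr fun k _ _ => h k (by omega) (by omega)]
  · rw [h i (by omega) (by omega)]

/-- Recentring at the walker's position turns absolute positions into displacements, which the steps
recorded in the cells determine. The window begins `N` cells before the observation time, hence the
index `N + j`. -/
theorem IsLocalTest.seenFrom_eq_windowFun (hf : IsLocalTest N M K f) (ω : Env d) (z : Steps d)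
    (j : ℕ) : f (seenFrom ω z (N + j)) = windowFun N M K f fun i => cells ω z (j + i) := by
  let w : ℤ → Cell d := fun k => cells ω z (k + N + j).toNat
  have hdisp : ∀ k, -(N : ℤ) ≤ k →
      displacement w k = pos z (k + N + j).toNat - pos z (N + j) := by
    -- Both functions of `k` have the same increments as long as `toNat` does not truncate, so their
    -- difference is constant; its value is then read off at `k = 0`.
    have key : ∀ k, -(N : ℤ) ≤ k → displacement w k - pos z (k + N + j).toNat =
        displacement w (-N) - pos z j := by
      intro k hk
      induction k, hk using Int.leInduction with
      | base => simp
      | succ k hk ih =>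
        have h1 : (k + 1 + N + j).toNat = (k + N + j).toNat + 1 := by omega
        have h2 : pos z ((k + N + j).toNat + 1) =
            pos z (k + N + j).toNat + (z (k + N + j).toNat).1 := Finset.sum_range_succ _ _
        rw [← ih, displacement_add_one, h1, h2]
        simp only [w, cells]
        abel
    intro k hk
    have h0 := key 0 (by omega)
    rw [← key k hk, displacement_zero, show (0 + (N : ℤ) + j).toNat = N + j by omega] at h0
    rw [eq_comm, sub_eq_iff_eq_add] at h0
    rw [h0]
    abel
  have h := hf.reconstruct_eq_windowFun w
  have hw : (fun i : Fin (N + M + K + 1) => w ((i : ℤ) - N)) =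
      fun i : Fin (N + M + K + 1) => cells ω z (j + i) := by
    funext i
    simp only [w]
    congr 1
    omega
  rw [← hw, ← h]
  refine hf.congr (fun p h1 h2 => ?_) fun i hi => ?_
  · dsimp only [reconstruct, shift]
    rw [hdisp p.1 h1]
    simp only [w, cells]
    congr 1
    ext1
    · simp only; push_cast; omega
    · simp only; abel
  · simp only [w, cells]
    congr 1
    omega

theorem IsLocalTest.abs_windowFun_le {C : ℝ} (hC : ∀ p, |f p| ≤ C)
    (v : Fin (N + M + K + 1) → Cell d) : |windowFun N M K f v| ≤ C := hC _

variable {P : Measure (Env d)} [IsProbabilityMeasure P]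

/-- The law of the environment and the steps under the tilt, for which the cells of the two-sided
path are i.i.d. -/
def tiltedLaw (P : Measure (Env d)) [IsProbabilityMeasure P] (θ : EuclideanSpace ℝ (Fin d)) :
    Measure (Env d × Steps d) :=
  (Measure.infinitePi fun _ : ℤ => cellLaw P θ).map reconstruct

theorem IsEllipticIID.isProbabilityMeasure_tiltedLaw (hP : IsEllipticIID P)
    (θ : EuclideanSpace ℝ (Fin d)) : IsProbabilityMeasure (tiltedLaw P θ) := by
  have := hP.isProbabilityMeasure_cellLaw θ
  exact Measure.isProbabilityMeasure_map measurable_reconstruct.aemeasurable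

theorem IsEllipticIID.integral_tiltedLaw (hP : IsEllipticIID P) (θ : EuclideanSpace ℝ (Fin d))
    (hf : IsLocalTest N M K f) :
    ∫ p, f p ∂(tiltedLaw P θ) = ∫ v, windowFun N M K f v ∂(Measure.pi fun _ => cellLaw P θ) := by
  have := hP.isProbabilityMeasure_cellLaw θ
  have hinj : Function.Injective fun i : Fin (N + M + K + 1) => ((i : ℕ) : ℤ) - N := by
    intro i j h
    simpa [Fin.val_inj] using h
  rw [tiltedLaw, integral_map measurable_reconstruct.aemeasurable
    hf.measurable.aestronglyMeasurable]
  simp_rw [hf.reconstruct_eq_windowFun]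
  rw [← Measure.infinitePi_eq_pi, ← Measure.map_infinitePi_infinitePi_of_inj
    (P := fun _ : ℤ => cellLaw P θ) hinj]
  have hm : Measurable fun (w : ℤ → Cell d) (i : Fin (N + M + K + 1)) => w ((i : ℤ) - N) :=
    measurable_pi_lambda _ fun i => measurable_pi_apply _
  exact (integral_map hm.aemeasurable hf.measurable_windowFun.aestronglyMeasurable).symm

/-- Both sides integrate the same window function against the product of `N + M + K + 1` copies of
the cell law. -/
theorem IsEllipticIID.averagedExp_eq_integral_tiltedLaw (hP : IsEllipticIID P)
    (θ : EuclideanSpace ℝ (Fin d)) (hf : IsLocalTest N M K f) :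
    averagedExp P (fun ω z => Real.exp (inner ℝ θ (toE (pos z (N + M + K + 1)))
      - ((N + M + K + 1 : ℕ) : ℝ) * logMGF P θ) * f (seenFrom ω z N)) =
      ∫ p, f p ∂(tiltedLaw P θ) := by
  obtain ⟨C, hC⟩ := hf.bounded
  rw [hP.integral_tiltedLaw θ hf, ← hP.averagedExp_cells θ hf.measurable_windowFun
    (IsLocalTest.abs_windowFun_le hC)]
  congr 1
  funext ω z
  have h := hf.seenFrom_eq_windowFun ω z 0
  simp only [zero_add, add_zero] at h
  rw [h]

theorem IsLocalTest.mono (hf : IsLocalTest N M K f) {N' M' K' : ℕ} (hN : N ≤ N') (hM : M ≤ M')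
    (hK : K ≤ K') : IsLocalTest N' M' K' f where
  bounded := hf.bounded
  steps ω z z' h := hf.steps ω z z' fun i hi => h i (hi.trans_le hK)
  env z := by
    refine (hf.env z).mono (inf_le_inf ?_ ?_) le_rfl
    · exact iSup_mono fun p => iSup_mono' fun h => ⟨by omega, le_rfl⟩
    · exact iSup_mono fun p => iSup_mono' fun h => ⟨by omega, le_rfl⟩

theorem IsLocalTest.mul {g : Env d × Steps d → ℝ} (hf : IsLocalTest N M K f)
    (hg : IsLocalTest N M K g) : IsLocalTest N M K fun p => f p * g p where
  bounded := by
    obtain ⟨C, hC⟩ := hf.bounded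
    obtain ⟨D, hD⟩ := hg.bounded
    refine ⟨C * D, fun p => ?_⟩
    rw [abs_mul]
    exact mul_le_mul (hC p) (hD p) (abs_nonneg _) ((abs_nonneg _).trans (hC p))
  steps ω z z' h := by rw [hf.steps ω z z' h, hg.steps ω z z' h]
  env z := (hf.env z).mul (hg.env z)

/-- The sets whose indicators are local test functions. -/
def localSets (d : ℕ) : Set (Set (Env d × Steps d)) :=
  {S | ∃ N M K : ℕ, IsLocalTest N M K (S.indicator fun _ => (1 : ℝ))}

theorem abs_indicator_one_le {α : Type*} (S : Set α) (p : α) :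
    |S.indicator (fun _ => (1 : ℝ)) p| ≤ 1 := by
  by_cases h : p ∈ S <;> simp [h]

/-- After enlarging both windows to a common one, the indicator of an intersection is a product of
local tests. -/
theorem isPiSystem_localSets : IsPiSystem (localSets d) := by
  rintro S ⟨N, M, K, hS⟩ T ⟨N', M', K', hT⟩ -
  refine ⟨max N N', max M M', max K K', ?_⟩
  have h := (hS.mono (le_max_left N N') (le_max_left M M') (le_max_left K K')).mul
    (hT.mono (le_max_right N N') (le_max_right M M') (le_max_right K K'))
  convert h using 1
  funext p
  by_cases h1 : p ∈ S <;> by_cases h2 : p ∈ T <;> simp [h1, h2]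

theorem measurableSet_of_mem_localSets {S : Set (Env d × Steps d)} (hS : S ∈ localSets d) :
    MeasurableSet S := by
  obtain ⟨N, M, K, h⟩ := hS
  have : S = (S.indicator fun _ => (1 : ℝ)) ⁻¹' {1} := by
    ext p
    by_cases h : p ∈ S <;> simp [h]
  rw [this]
  exact h.measurable (measurableSet_singleton 1)

theorem generateFrom_localSets :
    (inferInstance : MeasurableSpace (Env d × Steps d)) =
      MeasurableSpace.generateFrom (localSets d) := by
  refine le_antisymm (sup_le ?_ ?_)
    (MeasurableSpace.generateFrom_le fun S hS => measurableSet_of_mem_localSets hS)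
  · unfold MeasurableSpace.pi
    rw [MeasurableSpace.comap_iSup]
    refine iSup_le fun q => ?_
    rw [MeasurableSpace.comap_comp]
    rintro _ ⟨A, hA, rfl⟩
    -- The symmetric window of radius `|q.1|` contains the time of the coordinate `q`.
    refine MeasurableSpace.measurableSet_generateFrom ⟨q.1.natAbs, q.1.natAbs, 0, ⟨1, ?_⟩, ?_, ?_⟩
    · exact abs_indicator_one_le _
    · intro ω z z' _
      rfl
    · intro z
      have h1 : MeasurableSpace.comap (fun ω : Env d => ω q) inferInstance ≤
          futureSigma d (-(q.1.natAbs : ℤ)) ⊓ pastSigma d (q.1.natAbs : ℤ) :=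
        le_inf
          (le_iSup₂_of_le (f := fun (p : ℤ × Site d) (_ : -(q.1.natAbs : ℤ) ≤ p.1) =>
            MeasurableSpace.comap (fun ω : Env d => ω p) inferInstance) q (by omega) le_rfl)
          (le_iSup₂_of_le (f := fun (p : ℤ × Site d) (_ : p.1 ≤ (q.1.natAbs : ℤ)) =>
            MeasurableSpace.comap (fun ω : Env d => ω p) inferInstance) q (by omega) le_rfl)
      have h2 : Measurable (A.indicator fun _ => (1 : ℝ)) := measurable_const.indicator hA
      exact (h2.comp (comap_measurable fun ω : Env d => ω q)).mono h1 le_rfl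
  · unfold MeasurableSpace.pi
    rw [MeasurableSpace.comap_iSup]
    refine iSup_le fun i => ?_
    rw [MeasurableSpace.comap_comp]
    rintro _ ⟨A, hA, rfl⟩
    refine MeasurableSpace.measurableSet_generateFrom ⟨0, 0, i + 1, ⟨1, ?_⟩, ?_, ?_⟩
    · exact abs_indicator_one_le _
    · intro ω z z' h
      have h1 : (ω, z) ∈ (fun z : Steps d => z i) ∘ Prod.snd ⁻¹' A ↔
          (ω, z') ∈ (fun z : Steps d => z i) ∘ Prod.snd ⁻¹' A := by
        change z i ∈ A ↔ z' i ∈ A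
        rw [h i (by omega)]
      by_cases hz : (ω, z) ∈ (fun z : Steps d => z i) ∘ Prod.snd ⁻¹' A
      · exact (Set.indicator_of_mem hz _).trans (Set.indicator_of_mem (h1.1 hz) fun _ => (1 : ℝ)).symm
      · exact (Set.indicator_of_notMem hz _).trans
          (Set.indicator_of_notMem (fun h' => hz (h1.2 h')) fun _ => (1 : ℝ)).symm
    · intro z
      exact @measurable_const _ _ _ _ ((fun z : Steps d => z i) ⁻¹' A |>.indicator (fun _ => 1) z)

theorem ext_of_localTests {μ ν : Measure (Env d × Steps d)} [IsProbabilityMeasure ν]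
    (h : ∀ (N M K : ℕ) (f : Env d × Steps d → ℝ), IsLocalTest N M K f →
      ∫ p, f p ∂μ = ∫ p, f p ∂ν) : μ = ν := by
  have hreal : ∀ S ∈ localSets d, μ.real S = ν.real S := by
    intro S hS
    obtain ⟨N, M, K, hT⟩ := id hS
    have := h N M K _ hT
    rwa [integral_indicator_const _ (measurableSet_of_mem_localSets hS),
      integral_indicator_const _ (measurableSet_of_mem_localSets hS), smul_eq_mul, mul_one,
      smul_eq_mul, mul_one] at this
  have huniv : Set.univ ∈ localSets d :=
    ⟨0, 0, 0, ⟨1, abs_indicator_one_le _⟩, fun _ _ _ _ => by simp, fun z => by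
      simp only [Set.indicator_univ]; exact measurable_const⟩
  -- No finiteness of `μ` is assumed. Testing with the constant `1` gives real mass `1`, which rules
  -- out infinite mass since that would have real value `0`.
  have hμ : IsProbabilityMeasure μ := by
    constructor
    have h1 := hreal _ huniv
    rw [probReal_univ (μ := ν), Measure.real] at h1
    rwa [ENNReal.toReal_eq_one_iff] at h1
  refine ext_of_generate_finite _ generateFrom_localSets isPiSystem_localSets (fun S hS => ?_)
    (by simp)
  rw [← ENNReal.toReal_eq_toReal_iff' (measure_ne_top _ _) (measure_ne_top _ _)]
  exact hreal S hS

end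

/-! ### Exponential concentration along windows of an i.i.d. sequence. -/

section

variable {E : Type*} [MeasurableSpace E] (κ : Measure E) [IsProbabilityMeasure κ] {L : ℕ}
  {g : (Fin L → E) → ℝ}

theorem measurable_window (j : ℕ) : Measurable fun (w : ℕ → E) (i : Fin L) => w (j + i) :=
  measurable_pi_lambda _ fun _ => measurable_pi_apply _

theorem integral_window (hg : Measurable g) (j : ℕ) :
    ∫ w : ℕ → E, g (fun i => w (j + i)) ∂(Measure.infinitePi fun _ => κ) =
      ∫ v, g v ∂(Measure.pi fun _ => κ) := by
  have hinj : Function.Injective fun i : Fin L => j + (i : ℕ) := by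
    intro i k h
    simpa [Fin.val_inj] using h
  rw [← Measure.infinitePi_eq_pi, ← Measure.map_infinitePi_infinitePi_of_inj
    (P := fun _ : ℕ => κ) hinj]
  exact (integral_map (measurable_window j).aemeasurable hg.aestronglyMeasurable).symm

/-- Windows of length `L` whose starting points are congruent modulo `L` are disjoint: `j + i`
determines `i` modulo `L`, hence `i`, hence `j`. Thus they read independent blocks. -/
theorem iIndepFun_windows (hg : Measurable g) (r : ℕ) (c : ℝ) :
    iIndepFun (fun (j : {j : ℕ // j % L = r}) (w : ℕ → E) => g (fun i => w (j + i)) - c)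
      (Measure.infinitePi fun _ => κ) := by
  have hinj : Function.Injective fun p : {j : ℕ // j % L = r} × Fin L =>
      (p.1 : ℕ) + (p.2 : ℕ) := by
    rintro ⟨⟨j, hj⟩, i⟩ ⟨⟨j', hj'⟩, i'⟩ h
    simp only at h
    have h1 : (i : ℕ) = i' := by
      have h2 : (j + i) % L = (j' + i') % L := by rw [h]
      rw [Nat.add_mod, Nat.add_mod j', hj, hj'] at h2
      have h3 : (i : ℕ) ≡ i' [MOD L] :=
        Nat.ModEq.add_left_cancel' r (by
          change (r + (i : ℕ)) % L = (r + (i' : ℕ)) % L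
          rw [Nat.mod_eq_of_lt i.2, Nat.mod_eq_of_lt i'.2] at h2
          exact h2)
      rwa [Nat.ModEq, Nat.mod_eq_of_lt i.2, Nat.mod_eq_of_lt i'.2] at h3
    have h4 : i = i' := Fin.ext h1
    subst h4
    simpa using h
  have h1 := Measure.map_infinitePi_infinitePi_of_inj (P := fun _ : ℕ => κ) hinj
  have h2 := Measure.infinitePi_map_curry fun (_ : {j : ℕ // j % L = r}) (_ : Fin L) => κ
  have hm : Measurable fun (w : ℕ → E) (p : {j : ℕ // j % L = r} × Fin L) =>
      w ((p.1 : ℕ) + (p.2 : ℕ)) := measurable_pi_lambda _ fun _ => measurable_pi_apply _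
  rw [← h1, Measure.map_map (by fun_prop) hm] at h2
  have h3 : iIndepFun (fun (j : {j : ℕ // j % L = r}) (v : {j : ℕ // j % L = r} → Fin L → E) =>
      g (v j) - c) (Measure.infinitePi fun _ => Measure.infinitePi fun _ => κ) :=
    iIndepFun_infinitePi (X := fun _ v => g v - c) fun _ => hg.sub_const c
  have hmj : ∀ j : {j : ℕ // j % L = r}, Measurable fun w : ℕ → E =>
      g (fun i : Fin L => w (j + i)) - c := fun j => (hg.comp (measurable_window (j : ℕ))).sub_const c
  rw [iIndepFun_iff_map_fun_eq_infinitePi_map hmj]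
  have hmv : ∀ j : {j : ℕ // j % L = r}, Measurable fun v : {j : ℕ // j % L = r} → Fin L → E =>
      g (v j) - c := fun j => (hg.comp (measurable_pi_apply j)).sub_const c
  rw [iIndepFun_iff_map_fun_eq_infinitePi_map hmv, ← h2,
    Measure.map_map (measurable_pi_lambda _ hmv) ((MeasurableEquiv.measurable _).comp hm)] at h3
  refine Eq.trans ?_ (h3.trans ?_)
  · rfl
  · congr 1
    funext j
    rw [Measure.map_map (hmv j) ((MeasurableEquiv.measurable _).comp hm)]
    rfl

/-- Hoeffding's inequality for independent variables with values in `[-C, C]`, whose variance proxy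
is `C ^ 2`. There are at most `n` terms, and replacing their number by `n` only weakens the bound.
-/
theorem residue_sum_tail (hg : Measurable g) {C : ℝ} (hC : ∀ v, |g v| ≤ C) (hC0 : 0 < C)
    {δ : ℝ} (hδ : 0 < δ) (r n : ℕ) (hn : 0 < n) :
    (Measure.infinitePi fun _ : ℕ => κ).real {w | n * δ ≤ ∑ j ∈ Finset.range n with j % L = r,
        (g (fun i => w (j + i)) - ∫ v, g v ∂(Measure.pi fun _ => κ))} ≤
      Real.exp (-(δ ^ 2 / (2 * C ^ 2) * n)) := by
  set m := ∫ v, g v ∂(Measure.pi fun _ => κ) with hm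
  have hn' : (0 : ℝ) < n := Nat.cast_pos.mpr hn
  set s : Finset {j : ℕ // j % L = r} := (Finset.range n).subtype (· % L = r) with hs
  have hsum : ∀ w : ℕ → E, ∑ j ∈ Finset.range n with j % L = r, (g (fun i => w (j + i)) - m) =
      ∑ j ∈ s, (g (fun i => w (j + i)) - m) := fun w =>
    (Finset.sum_subtype_eq_sum_filter (p := (· % L = r))
      (fun j => g (fun i => w (j + i)) - m)).symm
  simp_rw [hsum]
  have hcard : s.card ≤ n := by
    rw [hs, Finset.card_subtype]
    exact (Finset.card_filter_le _ _).trans (Finset.card_range n).le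
  rcases s.eq_empty_or_nonempty with he | hne
  · have : {w : ℕ → E | n * δ ≤ ∑ j ∈ s, (g (fun i => w (j + i)) - m)} = ∅ := by
      ext w
      simp only [he, Finset.sum_empty, Set.mem_ofPred_eq, Set.mem_empty_iff_false, iff_false,
        not_le]
      positivity
    rw [this, measureReal_empty]
    exact (Real.exp_pos _).le
  · have hsub : ∀ j ∈ s, HasSubgaussianMGF (fun w : ℕ → E => g (fun i => w (j + i)) - m)
        ((‖C - -C‖₊ / 2) ^ 2) (Measure.infinitePi fun _ => κ) := by
      intro j _
      have := hasSubgaussianMGF_of_mem_Icc (μ := Measure.infinitePi fun _ : ℕ => κ)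
        (X := fun w => g (fun i => w (j + i))) (a := -C) (b := C)
        (hg.comp (measurable_window (j : ℕ))).aemeasurable
        (ae_of_all _ fun w => abs_le.mp (hC _))
      rwa [integral_window κ hg] at this
    have hind := iIndepFun_windows κ hg r m
    refine (HasSubgaussianMGF.measure_sum_ge_le_of_iIndepFun hind hsub (by positivity)).trans ?_
    have hc : (((‖C - -C‖₊ / 2) ^ 2 : NNReal) : ℝ) = C ^ 2 := by
      push_cast
      rw [Real.norm_of_nonneg (by linarith)]
      ring
    have hpos : (0 : ℝ) < s.card := Nat.cast_pos.mpr hne.card_pos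
    have hle : (s.card : ℝ) ≤ n := Nat.cast_le.mpr hcard
    rw [Real.exp_le_exp, Finset.sum_const, nsmul_eq_mul, NNReal.coe_mul, NNReal.coe_natCast, hc,
      neg_div, neg_le_neg_iff, div_mul_eq_mul_div, div_le_div_iff₀ (by positivity) (by positivity)]
    have h1 : δ ^ 2 * n * (2 * (s.card * C ^ 2)) ≤ δ ^ 2 * n * (2 * (n * C ^ 2)) := by gcongr
    nlinarith [h1]

theorem window_sum_tail (hL : 0 < L) (hg : Measurable g) {C : ℝ} (hC : ∀ v, |g v| ≤ C)
    (hC0 : 0 < C) {ε : ℝ} (hε : 0 < ε) :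
    ∃ γ > 0, ∀ n : ℕ, 0 < n →
      (Measure.infinitePi fun _ : ℕ => κ).real {w | n * ε ≤ ∑ j ∈ Finset.range n,
        (g (fun i => w (j + i)) - ∫ v, g v ∂(Measure.pi fun _ => κ))} ≤
      L * Real.exp (-(γ * n)) := by
  set m := ∫ v, g v ∂(Measure.pi fun _ => κ) with hm
  have hL' : (0 : ℝ) < L := Nat.cast_pos.mpr hL
  have hδ : 0 < ε / L := by positivity
  refine ⟨(ε / L) ^ 2 / (2 * C ^ 2), by positivity, fun n hn => ?_⟩
  -- If the whole sum reaches `n * ε`, one of the `L` residue classes must contribute at least `n *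
  -- (ε / L)`.
  have hsub : {w : ℕ → E | n * ε ≤ ∑ j ∈ Finset.range n, (g (fun i => w (j + i)) - m)} ⊆
      ⋃ r ∈ Finset.range L, {w | n * (ε / L) ≤ ∑ j ∈ Finset.range n with j % L = r,
        (g (fun i => w (j + i)) - m)} := by
    intro w hw
    simp only [Set.mem_ofPred_eq] at hw
    by_contra hcon
    simp only [Set.mem_iUnion, Set.mem_ofPred_eq, not_exists, not_le] at hcon
    have h1 := Finset.sum_fiberwise_of_maps_to (s := Finset.range n) (t := Finset.range L)
      (g := (· % L)) (fun j _ => Finset.mem_range.mpr (Nat.mod_lt j hL))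
      (fun j => g (fun i => w (j + i)) - m)
    have h2 := Finset.sum_lt_sum_of_nonempty (Finset.nonempty_range_iff.mpr hL.ne')
      fun r hr => hcon r hr
    rw [h1, Finset.sum_const, Finset.card_range, nsmul_eq_mul] at h2
    have h3 : (L : ℝ) * (n * (ε / L)) = n * ε := by field_simp
    linarith
  calc _ ≤ _ := measureReal_mono hsub (measure_ne_top _ _)
    _ ≤ _ := measureReal_biUnion_finset_le _ _
    _ ≤ ∑ _r ∈ Finset.range L, Real.exp (-((ε / L) ^ 2 / (2 * C ^ 2) * n)) :=
        Finset.sum_le_sum fun r _ => residue_sum_tail κ hg hC hC0 hδ r n hn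
    _ = _ := by rw [Finset.sum_const, Finset.card_range, nsmul_eq_mul]

/-- Averages of a bounded function along the windows of an i.i.d. sequence concentrate
exponentially. -/
theorem abs_window_sum_tail (hL : 0 < L) (hg : Measurable g) {C : ℝ} (hC : ∀ v, |g v| ≤ C)
    {ε : ℝ} (hε : 0 < ε) :
    ∃ γ > 0, ∀ n : ℕ,
      (Measure.infinitePi fun _ : ℕ => κ).real {w | n * ε < |∑ j ∈ Finset.range n,
        g (fun i => w (j + i)) - n * ∫ v, g v ∂(Measure.pi fun _ => κ)|} ≤
      2 * L * Real.exp (-(γ * n)) := by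
  -- Hoeffding's bound divides by the square of the bound on `g`, so a strictly positive bound is
  -- needed.
  have hC' : ∀ v, |g v| ≤ |C| + 1 := fun v => (hC v).trans ((le_abs_self C).trans (by linarith))
  obtain ⟨γ₁, hγ₁, h₁⟩ := window_sum_tail κ hL hg hC' (by positivity) hε
  obtain ⟨γ₂, hγ₂, h₂⟩ := window_sum_tail κ hL hg.neg (g := fun v => -g v) (fun v => by
    rw [abs_neg]; exact hC' v) (by positivity) hε
  refine ⟨min γ₁ γ₂, lt_min hγ₁ hγ₂, fun n => ?_⟩
  have hL1 : (1 : ℝ) ≤ L := by exact_mod_cast hL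
  rcases Nat.eq_zero_or_pos n with rfl | hn
  · refine measureReal_le_one.trans ?_
    simp only [Nat.cast_zero, mul_zero, neg_zero, Real.exp_zero, mul_one]
    linarith
  have hsub : {w : ℕ → E | n * ε < |∑ j ∈ Finset.range n,
        g (fun i => w (j + i)) - n * ∫ v, g v ∂(Measure.pi fun _ => κ)|} ⊆
      {w | n * ε ≤ ∑ j ∈ Finset.range n,
        (g (fun i => w (j + i)) - ∫ v, g v ∂(Measure.pi fun _ => κ))} ∪
      {w | n * ε ≤ ∑ j ∈ Finset.range n,
        (-g (fun i => w (j + i)) - ∫ v, -g v ∂(Measure.pi fun _ => κ))} := by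
    intro w hw
    simp only [Set.mem_union, Set.mem_ofPred_eq, Finset.sum_sub_distrib, Finset.sum_const,
      Finset.card_range, nsmul_eq_mul, Finset.sum_neg_distrib, integral_neg] at hw ⊢
    rcases lt_abs.mp hw with h | h
    · left; linarith
    · right; linarith
  have hmono : ∀ γ, min γ₁ γ₂ ≤ γ → Real.exp (-(γ * n)) ≤ Real.exp (-(min γ₁ γ₂ * n)) := by
    intro γ hγ
    rw [Real.exp_le_exp, neg_le_neg_iff]
    gcongr
  calc _ ≤ _ := measureReal_mono hsub (measure_ne_top _ _)
    _ ≤ _ := measureReal_union_le _ _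
    _ ≤ L * Real.exp (-(min γ₁ γ₂ * n)) + L * Real.exp (-(min γ₁ γ₂ * n)) := by
      refine add_le_add ((h₁ n hn).trans ?_) ((h₂ n hn).trans ?_)
      · exact mul_le_mul_of_nonneg_left (hmono _ (min_le_left _ _)) (Nat.cast_nonneg _)
      · exact mul_le_mul_of_nonneg_left (hmono _ (min_le_right _ _)) (Nat.cast_nonneg _)
    _ = _ := by ring

end

/-! ### Convex analysis of `Λ_c`. -/

section

variable {d : ℕ} {P : Measure (Env d)} [IsProbabilityMeasure P]

theorem hasFDerivAt_inner_const (v θ : EuclideanSpace ℝ (Fin d)) :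
    HasFDerivAt (fun θ : EuclideanSpace ℝ (Fin d) => inner ℝ θ v) (innerSL ℝ v) θ :=
  (innerSL ℝ v).hasFDerivAt.congr_of_eventuallyEq
    (Eventually.of_forall fun θ' => (real_inner_comm θ' v).symm)

theorem IsEllipticIID.hasFDerivAt_logMGF (hP : IsEllipticIID P) (θ : EuclideanSpace ℝ (Fin d)) :
    HasFDerivAt (logMGF P) ((∑ z : Step d, meanStep P z * Real.exp (inner ℝ θ (toE z.1)))⁻¹ •
      ∑ z : Step d, meanStep P z • Real.exp (inner ℝ θ (toE z.1)) • innerSL ℝ (toE z.1)) θ := by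
  have h1 : ∀ z : Step d, HasFDerivAt (fun θ : EuclideanSpace ℝ (Fin d) =>
      meanStep P z * Real.exp (inner ℝ θ (toE z.1)))
      (meanStep P z • Real.exp (inner ℝ θ (toE z.1)) • innerSL ℝ (toE z.1)) θ := by
    intro z
    exact (hasFDerivAt_inner_const _ θ).exp.const_mul _
  exact (HasFDerivAt.fun_sum fun z _ => h1 z).log (hP.mgf_pos θ).ne'

/-- The critical-point equation with its denominator cleared: `ξ` is the mean step under the tilted
weights. -/
theorem IsEllipticIID.hasGradientAt_iff (hP : IsEllipticIID P)
    (θ ξ : EuclideanSpace ℝ (Fin d)) :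
    HasGradientAt (logMGF P) ξ θ ↔ ∀ v : EuclideanSpace ℝ (Fin d), ∑ z : Step d,
      meanStep P z * Real.exp (inner ℝ θ (toE z.1)) * inner ℝ v (toE z.1 - ξ) = 0 := by
  set S := ∑ z : Step d, meanStep P z * Real.exp (inner ℝ θ (toE z.1)) with hS
  have hpos : 0 < S := hP.mgf_pos θ
  have happ : ∀ v : EuclideanSpace ℝ (Fin d), ∑ z : Step d,
      meanStep P z * Real.exp (inner ℝ θ (toE z.1)) * inner ℝ v (toE z.1 - ξ) =
      S * (((S)⁻¹ • ∑ z : Step d, meanStep P z • Real.exp (inner ℝ θ (toE z.1)) •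
        innerSL ℝ (toE z.1)) v - InnerProductSpace.toDual ℝ _ ξ v) := by
    intro v
    simp only [smul_apply, sum_apply, innerSL_apply_apply,
      smul_eq_mul, InnerProductSpace.toDual_apply_apply, inner_sub_right, mul_sub,
      Finset.sum_sub_distrib, ← Finset.sum_mul, ← hS, mul_inv_cancel_left₀ hpos.ne']
    rw [real_inner_comm ξ v]
    congr 1
    exact Finset.sum_congr rfl fun z _ => by rw [real_inner_comm v]; ring
  have hd := hP.hasFDerivAt_logMGF θ
  constructor
  · intro h v
    rw [happ, hd.unique h.hasFDerivAt, sub_self, mul_zero]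
  · intro h
    rw [hasGradientAt_iff_hasFDerivAt]
    convert! hd using 1
    ext1 v
    have h1 := h v
    rw [happ, mul_eq_zero, sub_eq_zero] at h1
    exact (h1.resolve_left hpos.ne').symm

theorem IsEllipticIID.logMGF_sub (hP : IsEllipticIID P) (θ ξ : EuclideanSpace ℝ (Fin d)) :
    logMGF P θ - inner ℝ θ ξ =
      Real.log (∑ z : Step d, meanStep P z * Real.exp (inner ℝ θ (toE z.1 - ξ))) := by
  simp_rw [inner_sub_right, Real.exp_sub, ← mul_div_assoc]
  rw [← Finset.sum_div, Real.log_div (hP.mgf_pos θ).ne' (Real.exp_pos _).ne', Real.log_exp, logMGF]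

theorem IsEllipticIID.sum_exp_sub_pos (hP : IsEllipticIID P) (θ ξ : EuclideanSpace ℝ (Fin d)) :
    0 < ∑ z : Step d, meanStep P z * Real.exp (inner ℝ θ (toE z.1 - ξ)) := by
  simp_rw [inner_sub_right, Real.exp_sub, ← mul_div_assoc]
  rw [← Finset.sum_div]
  exact div_pos (hP.mgf_pos θ) (Real.exp_pos _)

/-- The tangent line of the exponential lies below its graph, strictly away from the base point. -/
theorem IsEllipticIID.sum_exp_tangent (hP : IsEllipticIID P) {θ ξ : EuclideanSpace ℝ (Fin d)}
    (h : HasGradientAt (logMGF P) ξ θ) (θ' : EuclideanSpace ℝ (Fin d)) :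
    ∑ z : Step d, meanStep P z * Real.exp (inner ℝ θ (toE z.1 - ξ)) =
      ∑ z : Step d, meanStep P z * (Real.exp (inner ℝ θ (toE z.1 - ξ)) *
        (inner ℝ (θ' - θ) (toE z.1 - ξ) + 1)) := by
  have h0 := (hP.hasGradientAt_iff θ ξ).1 h (θ' - θ)
  have h1 : ∑ z : Step d, meanStep P z * (Real.exp (inner ℝ θ (toE z.1 - ξ)) *
        inner ℝ (θ' - θ) (toE z.1 - ξ)) = 0 := by
    rw [← zero_mul (Real.exp (-inner ℝ θ ξ)), ← h0, Finset.sum_mul]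
    refine Finset.sum_congr rfl fun z _ => ?_
    rw [inner_sub_right θ, sub_eq_add_neg, Real.exp_add]
    ring
  simp_rw [mul_add, Finset.sum_add_distrib, mul_one]
  rw [h1, zero_add]

theorem exp_inner_eq (θ θ' v : EuclideanSpace ℝ (Fin d)) :
    Real.exp (inner ℝ θ' v) = Real.exp (inner ℝ θ v) * Real.exp (inner ℝ (θ' - θ) v) := by
  rw [← Real.exp_add, ← inner_add_left, add_sub_cancel]

/-- Apply `1 + t ≤ exp t` to each step; the linear terms cancel by the gradient equation. A critical
point is thus a global minimiser. -/
theorem IsEllipticIID.sum_exp_le (hP : IsEllipticIID P) {θ ξ : EuclideanSpace ℝ (Fin d)}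
    (h : HasGradientAt (logMGF P) ξ θ) (θ' : EuclideanSpace ℝ (Fin d)) :
    ∑ z : Step d, meanStep P z * Real.exp (inner ℝ θ (toE z.1 - ξ)) ≤
      ∑ z : Step d, meanStep P z * Real.exp (inner ℝ θ' (toE z.1 - ξ)) := by
  rw [hP.sum_exp_tangent h θ']
  refine Finset.sum_le_sum fun z _ => ?_
  rw [exp_inner_eq θ θ']
  exact mul_le_mul_of_nonneg_left (mul_le_mul_of_nonneg_left (Real.add_one_le_exp _)
    (Real.exp_pos _).le) (hP.meanStep_pos z).le

/-- Taking logarithms in `IsEllipticIID.sum_exp_le` shows that the supremum is attained at `θ`. This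
turns the quenched lower bound into one with the exponent produced by the tilt. -/
theorem IsEllipticIID.averagedRate_le (hP : IsEllipticIID P) {θ ξ : EuclideanSpace ℝ (Fin d)}
    (h : HasGradientAt (logMGF P) ξ θ) :
    averagedRate P ξ ≤ ((inner ℝ θ ξ - logMGF P θ : ℝ) : EReal) := by
  refine iSup_le fun θ' => EReal.coe_le_coe_iff.2 ?_
  have h1 := Real.log_le_log (hP.sum_exp_sub_pos θ ξ) (hP.sum_exp_le h θ')
  rw [← hP.logMGF_sub, ← hP.logMGF_sub] at h1
  linarith

theorem inner_toE (v : EuclideanSpace ℝ (Fin d)) (x : Site d) :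
    inner ℝ v (toE x) = ∑ i, v i * x i := by
  simp [PiLp.inner_apply, toE, mul_comm]

/-- The step in direction `s` along the `i`-th coordinate axis. -/
def axisStep (i : Fin d) (s : ℤˣ) : Step d :=
  ⟨Pi.single i (s : ℤ), by
    rw [Finset.sum_eq_single i]
    · rcases Int.units_eq_one_or s with rfl | rfl <;> simp
    · intro j _ hj
      simp [hj]
    · simp⟩

theorem inner_axisStep (v : EuclideanSpace ℝ (Fin d)) (i : Fin d) (s : ℤˣ) :
    inner ℝ v (toE (axisStep i s).1) = v i * ((s : ℤ) : ℝ) := by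
  rw [inner_toE, Finset.sum_eq_single i]
  · simp [axisStep]
  · intro j _ hj
    simp [axisStep, hj]
  · simp

/-- `Λ_c` is strictly convex, so that its gradient is injective. -/
theorem IsEllipticIID.hasGradientAt_injective (hP : IsEllipticIID P)
    {θ θ' ξ : EuclideanSpace ℝ (Fin d)} (h : HasGradientAt (logMGF P) ξ θ)
    (h' : HasGradientAt (logMGF P) ξ θ') : θ' = θ := by
  -- A nonzero value for some step would make `1 + t < exp t` strict there, although both `θ` and
  -- `θ'` are minimisers.
  have hz : ∀ z : Step d, inner ℝ (θ' - θ) (toE z.1 - ξ) = 0 := by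
    by_contra hcon
    push Not at hcon
    obtain ⟨z, hz⟩ := hcon
    refine lt_irrefl (∑ z : Step d, meanStep P z * Real.exp (inner ℝ θ (toE z.1 - ξ))) ?_
    refine lt_of_lt_of_le ?_ (hP.sum_exp_le h' θ)
    rw [hP.sum_exp_tangent h θ']
    refine Finset.sum_lt_sum (fun z _ => ?_) ⟨z, Finset.mem_univ z, ?_⟩
    · rw [exp_inner_eq θ θ']
      exact mul_le_mul_of_nonneg_left (mul_le_mul_of_nonneg_left (Real.add_one_le_exp _)
        (Real.exp_pos _).le) (hP.meanStep_pos z).le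
    · rw [exp_inner_eq θ θ']
      exact mul_lt_mul_of_pos_left (mul_lt_mul_of_pos_left (Real.add_one_lt_exp hz)
        (Real.exp_pos _)) (hP.meanStep_pos z)
  ext i
  -- Subtracting the identities for the two opposite steps eliminates `ξ` and leaves the `i`-th
  -- coordinate of `θ' - θ`.
  have h1 := hz (axisStep i 1)
  have h2 := hz (axisStep i (-1))
  rw [inner_sub_right, inner_axisStep] at h1 h2
  simp at h1 h2
  linarith

theorem sum_abs_lt_one_of_mem_interior {ξ : EuclideanSpace ℝ (Fin d)}
    (hξ : ξ ∈ interior (velocityDomain d)) : ∑ i, |ξ i| < 1 := by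
  rw [mem_interior_iff_mem_nhds] at hξ
  -- An interior point can be dilated slightly and stay in the domain, which is impossible if its
  -- `ℓ¹` norm is already at least `1`.
  have hc : Tendsto (fun t : ℝ => (1 + t) • ξ) (𝓝[>] 0) (𝓝 ξ) := by
    have : Tendsto (fun t : ℝ => (1 + t) • ξ) (𝓝 0) (𝓝 ((1 + (0 : ℝ)) • ξ)) :=
      Continuous.tendsto (by fun_prop) 0
    rw [add_zero, one_smul] at this
    exact this.mono_left nhdsWithin_le_nhds
  obtain ⟨t, ht, ht0⟩ := ((hc.eventually hξ).and self_mem_nhdsWithin).exists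
  have ht0' : (0 : ℝ) < t := ht0
  have h1 : ∑ i, |((1 + t) • ξ) i| ≤ 1 := ht
  simp only [PiLp.smul_apply, smul_eq_mul, abs_mul, ← Finset.mul_sum,
    abs_of_pos (show (0 : ℝ) < 1 + t by linarith)] at h1
  by_contra hcon
  push Not at hcon
  nlinarith

theorem IsEllipticIID.log_meanStep_add_le (hP : IsEllipticIID P) (θ : EuclideanSpace ℝ (Fin d))
    (z : Step d) : Real.log (meanStep P z) + inner ℝ θ (toE z.1) ≤ logMGF P θ := by
  rw [← Real.log_exp (inner ℝ θ (toE z.1)), ← Real.log_mul (hP.meanStep_pos z).ne'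
    (Real.exp_pos _).ne']
  refine Real.log_le_log (mul_pos (hP.meanStep_pos z) (Real.exp_pos _)) ?_
  exact Finset.single_le_sum (f := fun z : Step d => meanStep P z * Real.exp (inner ℝ θ (toE z.1)))
    (fun z _ => (mul_pos (hP.meanStep_pos z) (Real.exp_pos _)).le) (Finset.mem_univ z)

/-- `Λ_c(θ) - ⟨θ, ξ⟩` is continuous and coercive, so it has a minimiser, where the gradient equation
holds. -/
theorem IsEllipticIID.exists_hasGradientAt (hP : IsEllipticIID P) {ξ : EuclideanSpace ℝ (Fin d)}
    (hξ : ξ ∈ interior (velocityDomain d)) : ∃ θ, HasGradientAt (logMGF P) ξ θ := by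
  have hs := sum_abs_lt_one_of_mem_interior hξ
  set s := ∑ i, |ξ i| with hsdef
  obtain ⟨ω⟩ : Nonempty (Env d) := nonempty_of_isProbabilityMeasure P
  have hne := ω.nonempty_step
  obtain ⟨z₁, hz₁⟩ := Finite.exists_min (meanStep P)
  have hd : 0 < d := by
    rcases Nat.eq_zero_or_pos d with rfl | h
    · have := z₁.2
      simp at this
    · exact h
  have : Nonempty (Fin d) := ⟨⟨0, hd⟩⟩
  -- Keep only the step along the largest coordinate `|θ i|`, with the sign of `θ i`. It contributes
  -- `|θ i|` to `Λ_c`, whereas `⟨θ, ξ⟩ ≤ s * |θ i|`; the factor `1 / d` comes from `‖θ‖ ≤ d * |θ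
  -- i|`.
  have hlower : ∀ θ : EuclideanSpace ℝ (Fin d),
      Real.log (meanStep P z₁) + (1 - s) / d * ‖θ‖ ≤ logMGF P θ - inner ℝ θ ξ := by
    intro θ
    obtain ⟨i, hi⟩ := Finite.exists_max fun i => |θ i|
    have h1 : ∃ z : Step d, inner ℝ θ (toE z.1) = |θ i| := by
      rcases abs_cases (θ i) with ⟨h, _⟩ | ⟨h, _⟩
      · exact ⟨axisStep i 1, by rw [inner_axisStep, h]; simp⟩
      · exact ⟨axisStep i (-1), by rw [inner_axisStep, h]; simp⟩
    obtain ⟨z, hz⟩ := h1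
    have h2 := hP.log_meanStep_add_le θ z
    rw [hz] at h2
    have h3 : Real.log (meanStep P z₁) ≤ Real.log (meanStep P z) :=
      Real.log_le_log (hP.meanStep_pos _) (hz₁ z)
    have h4 : inner ℝ θ ξ ≤ |θ i| * s := by
      rw [PiLp.inner_apply, hsdef, Finset.mul_sum]
      refine Finset.sum_le_sum fun j _ => ?_
      calc inner ℝ (θ j) (ξ j) ≤ |θ j * ξ j| := by
            rw [mul_comm]; exact le_abs_self _
        _ = |θ j| * |ξ j| := abs_mul _ _
        _ ≤ _ := mul_le_mul_of_nonneg_right (hi j) (abs_nonneg _)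
    have h5 : ‖θ‖ ≤ d * |θ i| := by
      refine abs_le_of_sq_le_sq' ?_ (by positivity) |>.2
      rw [EuclideanSpace.norm_sq_eq]
      have hd1 : (1 : ℝ) ≤ d := by exact_mod_cast hd
      calc ∑ j, ‖θ j‖ ^ 2 ≤ ∑ _j : Fin d, |θ i| ^ 2 := Finset.sum_le_sum fun j _ => by
            rw [Real.norm_eq_abs]; exact pow_le_pow_left₀ (abs_nonneg _) (hi j) 2
        _ = d * |θ i| ^ 2 := by simp
        _ ≤ d * (d * |θ i| ^ 2) := by
            nlinarith [sq_nonneg |θ i|, mul_nonneg (Nat.cast_nonneg (α := ℝ) d) (sq_nonneg |θ i|)]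
        _ = _ := by ring
    have hd0 : (0 : ℝ) < d := Nat.cast_pos.mpr hd
    have h6 : (1 - s) / d * ‖θ‖ ≤ (1 - s) * |θ i| := by
      calc (1 - s) / d * ‖θ‖ ≤ (1 - s) / d * (d * |θ i|) :=
            mul_le_mul_of_nonneg_left h5 (div_nonneg (by linarith) hd0.le)
        _ = _ := by field_simp
    linarith
  have hcont : Continuous fun θ : EuclideanSpace ℝ (Fin d) => logMGF P θ - inner ℝ θ ξ :=
    (continuous_iff_continuousAt.2 fun θ => (hP.hasFDerivAt_logMGF θ).continuousAt).sub
      (by fun_prop)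
  have htend : Tendsto (fun θ : EuclideanSpace ℝ (Fin d) => logMGF P θ - inner ℝ θ ξ)
      (cocompact _) atTop := by
    refine tendsto_atTop_mono hlower (tendsto_atTop_add_const_left _ _ ?_)
    exact (tendsto_norm_cocompact_atTop).const_mul_atTop
      (div_pos (by linarith) (Nat.cast_pos.mpr hd))
  obtain ⟨θ, hθ⟩ := hcont.exists_forall_le htend
  refine ⟨θ, ?_⟩
  have hmin : IsLocalMin (fun θ : EuclideanSpace ℝ (Fin d) => logMGF P θ - inner ℝ θ ξ) θ :=
    Eventually.of_forall hθ
  have hder := hP.hasFDerivAt_logMGF θ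
  have h0 := hmin.hasFDerivAt_eq_zero (hder.sub (hasFDerivAt_inner_const ξ θ))
  rw [sub_eq_zero] at h0
  rw [h0] at hder
  exact hder

end

/-! ### From mean bounds to almost sure bounds, and logarithmic scaling. -/

/-- Markov's inequality at level `exp(-γn/2)` leaves exceptional probabilities of order
`exp(-γn/2)`, which are summable, and Borel–Cantelli applies. -/
theorem ae_eventually_le_exp {Ω : Type*} [MeasurableSpace Ω] {Q : Measure Ω} [IsFiniteMeasure Q]
    {r : ℕ → Ω → ℝ} (h0 : ∀ n ω, 0 ≤ r n ω) (hint : ∀ n, Integrable (r n) Q) {A γ : ℝ} (hγ : 0 < γ)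
    (h : ∀ n : ℕ, ∫ ω, r n ω ∂Q ≤ A * Real.exp (-(γ * n))) :
    ∀ᵐ ω ∂Q, ∀ᶠ n : ℕ in atTop, r n ω ≤ Real.exp (-(γ / 2 * n)) := by
  have hbound : ∀ n : ℕ, Q {ω | Real.exp (-(γ / 2 * n)) ≤ r n ω} ≤
      ENNReal.ofReal (A * Real.exp (-(γ / 2)) ^ n) := by
    intro n
    have h1 := mul_meas_ge_le_integral_of_nonneg (ae_of_all Q (h0 n)) (hint n)
      (Real.exp (-(γ / 2 * n)))
    rw [ENNReal.le_ofReal_iff_toReal_le (measure_ne_top _ _)]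
    · have h2 : Real.exp (-(γ / 2 * n)) * Q.real {ω | Real.exp (-(γ / 2 * n)) ≤ r n ω} ≤
          Real.exp (-(γ / 2 * n)) * (A * Real.exp (-(γ / 2)) ^ n) := by
        refine h1.trans ((h n).trans_eq ?_)
        rw [← Real.exp_nat_mul, mul_left_comm, ← Real.exp_add]
        congr 2
        ring
      exact le_of_mul_le_mul_left h2 (Real.exp_pos _)
    · have h3 := (integral_nonneg (h0 n)).trans (h n)
      have h4 : 0 ≤ A := nonneg_of_mul_nonneg_left h3 (Real.exp_pos _)
      positivity
  have hsum : Summable fun n : ℕ => A * Real.exp (-(γ / 2)) ^ n :=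
    (summable_geometric_of_lt_one (Real.exp_pos _).le
      (Real.exp_lt_one_iff.mpr (by linarith))).mul_left A
  have hne : ∑' n : ℕ, Q {ω | Real.exp (-(γ / 2 * n)) ≤ r n ω} ≠ ∞ :=
    ne_top_of_le_ne_top hsum.tsum_ofReal_ne_top (ENNReal.tsum_le_tsum hbound)
  filter_upwards [ae_eventually_notMem hne] with ω hω
  filter_upwards [hω] with n hn
  exact (not_le.mp hn).le

theorem scaledLog_le {n : ℕ} (hn : 0 < n) {p : ℝ≥0∞} {a : ℝ}
    (h : p ≤ ENNReal.ofReal (Real.exp (n * a))) : scaledLog n p ≤ a := by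
  have h1 : ENNReal.log p ≤ ((n * a : ℝ) : EReal) := by
    refine (ENNReal.log_monotone h).trans_eq ?_
    rw [← EReal.exp_coe, EReal.log_exp]
  have hn' : (n : ℝ) ≠ 0 := Nat.cast_ne_zero.mpr hn.ne'
  calc scaledLog n p ≤ (((n : ℝ)⁻¹ : ℝ) : EReal) * ((n * a : ℝ) : EReal) :=
        mul_le_mul_of_nonneg_left h1 (by exact_mod_cast inv_nonneg.mpr (Nat.cast_nonneg n))
    _ = a := by
        rw [← EReal.coe_mul, inv_mul_cancel_left₀ hn']

theorem le_of_lt_scaledLog {n : ℕ} (hn : 0 < n) {p : ℝ≥0∞} {a : ℝ} (h : (a : EReal) < scaledLog n p) :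
    ENNReal.ofReal (Real.exp (n * a)) ≤ p := by
  by_contra hcon
  exact absurd (scaledLog_le hn (not_le.mp hcon).le) (not_le.mpr h)

/-! ### Quenched deviations conditioned on the velocity. -/

section

variable {d : ℕ}

theorem measurable_of_dependsOn_steps {α : Type*} [MeasurableSpace α] {F : Steps d → α} (n : ℕ)
    (hF : ∀ x y : Steps d, (∀ i < n, x i = y i) → F x = F y) : Measurable F := by
  rcases isEmpty_or_nonempty (Step d) with h | ⟨⟨z₀⟩⟩
  · have : IsEmpty (Steps d) := ⟨fun z => h.false (z 0)⟩
    exact measurable_of_empty F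
  · have h1 : F = (fun a : Fin n → Step d => F (extendSteps z₀ a)) ∘ fun x i => x i := by
      funext x
      exact hF _ _ fun i hi => by simp [extendSteps, hi]
    rw [h1]
    exact (measurable_of_countable _).comp (by fun_prop)

theorem integrable_quenchedLaw (ω : Env d) {F : Steps d → ℝ} (n : ℕ)
    (hF : ∀ x y : Steps d, (∀ i < n, x i = y i) → F x = F y) : Integrable F (quenchedLaw ω) := by
  obtain ⟨z₀⟩ := ω.nonempty_step
  have hm : Measurable fun (x : Steps d) (i : Fin n) => x i := by fun_prop
  have h1 : F = (fun a : Fin n → Step d => F (extendSteps z₀ a)) ∘ fun x i => x i := by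
    funext x
    exact hF _ _ fun i hi => by simp [extendSteps, hi]
  rw [h1]
  have : IsProbabilityMeasure ((quenchedLaw ω).map fun (x : Steps d) (i : Fin n) => x i) :=
    Measure.isProbabilityMeasure_map hm.aemeasurable
  exact Integrable.comp_measurable .of_finite hm

theorem abs_inner_step_le (θ : EuclideanSpace ℝ (Fin d)) (z : Step d) :
    |inner ℝ θ (toE z.1)| ≤ ‖θ‖ := by
  have hz : ∑ i, |(z.1 i : ℝ)| = 1 := by exact_mod_cast z.2
  rw [inner_toE]
  calc |∑ i, θ i * z.1 i| ≤ ∑ i, |θ i * z.1 i| := Finset.abs_sum_le_sum_abs _ _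
    _ ≤ ∑ i, ‖θ‖ * |(z.1 i : ℝ)| := Finset.sum_le_sum fun i _ => by
        rw [abs_mul]
        exact mul_le_mul_of_nonneg_right (PiLp.norm_apply_le θ i) (abs_nonneg _)
    _ = ‖θ‖ := by rw [← Finset.mul_sum, hz, mul_one]

theorem inner_pos_add_ge (θ : EuclideanSpace ℝ (Fin d)) (z : Steps d) (n l : ℕ) :
    inner ℝ θ (toE (pos z n)) - l * ‖θ‖ ≤ inner ℝ θ (toE (pos z (n + l))) := by
  rw [inner_toE_pos, inner_toE_pos, Finset.sum_range_add]
  have h : ∑ _i ∈ Finset.range l, -‖θ‖ ≤ ∑ i ∈ Finset.range l, inner ℝ θ (toE (z (n + i)).1) :=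
    Finset.sum_le_sum fun i _ => (abs_le.mp (abs_inner_step_le θ _)).1
  rw [Finset.sum_const, Finset.card_range, nsmul_eq_mul] at h
  linarith

theorem inner_pos_ge {θ ξ : EuclideanSpace ℝ (Fin d)} {z : Steps d} {n : ℕ} (hn : 0 < n) {δ : ℝ}
    (h : ‖velocity z n - ξ‖ ≤ δ) :
    n * (inner ℝ θ ξ - ‖θ‖ * δ) ≤ inner ℝ θ (toE (pos z n)) := by
  have hn' : (0 : ℝ) < n := Nat.cast_pos.mpr hn
  have h1 : inner ℝ θ (toE (pos z n)) = n * inner ℝ θ (velocity z n) := by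
    rw [velocity, real_inner_smul_right, mul_inv_cancel_left₀ hn'.ne']
  rw [h1]
  refine mul_le_mul_of_nonneg_left ?_ hn'.le
  have h2 : inner ℝ θ (velocity z n) = inner ℝ θ ξ + inner ℝ θ (velocity z n - ξ) := by
    rw [← inner_add_right, add_sub_cancel]
  have h3 := (abs_le.mp (abs_real_inner_le_norm θ (velocity z n - ξ))).1
  have h4 := mul_le_mul_of_nonneg_left h (norm_nonneg θ)
  linarith

variable {N M K : ℕ} {f : Env d × Steps d → ℝ}

theorem IsLocalTest.integral_empiricalProcess (hf : IsLocalTest N M K f) (ω : Env d)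
    (z : Steps d) (n : ℕ) :
    ∫ p, f p ∂(empiricalProcess ω z n) = (n : ℝ)⁻¹ * ∑ j ∈ Finset.range n, f (seenFrom ω z j) := by
  rw [empiricalProcess, integral_smul_measure, integral_finsetSum_measure fun j _ =>
    integrable_dirac' hf.measurable.stronglyMeasurable (by simp)]
  simp_rw [integral_dirac' _ _ hf.measurable.stronglyMeasurable]
  simp

/-- The cells for which the average of a local function over `n` windows deviates from `m`. -/
def deviantCells (N M K : ℕ) (f : Env d × Steps d → ℝ) (m ε : ℝ) (n : ℕ) :
    Set (Fin (n + (N + M + K + 1)) → Cell d) :=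
  {v | n * ε < |∑ j : Fin n, windowFun N M K f (fun i => v ⟨j + i, by omega⟩) - n * m|}

theorem IsLocalTest.measurableSet_deviantCells (hf : IsLocalTest N M K f) (m ε : ℝ) (n : ℕ) :
    MeasurableSet (deviantCells N M K f m ε n) := by
  refine measurableSet_lt measurable_const (Measurable.abs (Measurable.sub_const ?_ _))
  exact Finset.measurable_sum _ fun j _ => hf.measurable_windowFun.comp
    (measurable_pi_lambda _ fun i => measurable_pi_apply _)

theorem mem_deviantCells_iff (w : ℕ → Cell d) (m ε : ℝ) (n : ℕ) :
    (fun i : Fin (n + (N + M + K + 1)) => w i) ∈ deviantCells N M K f m ε n ↔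
      n * ε < |∑ j ∈ Finset.range n, windowFun N M K f (fun i => w (j + i)) - n * m| := by
  rw [← Fin.sum_univ_eq_sum_range fun j => windowFun N M K f fun i => w (j + i)]
  rfl

/-- Shifting the range changes only `N` terms at each end. The shift is needed because the window
observed from time `j` starts at `j - N`, so the first `N` times have no full window. -/
theorem abs_sum_range_add_sub_le {a : ℕ → ℝ} {C : ℝ} (hC : ∀ j, |a j| ≤ C) (N n : ℕ) :
    |∑ j ∈ Finset.range n, a (N + j) - ∑ j ∈ Finset.range n, a j| ≤ 2 * N * C := by
  have h1 := Finset.sum_range_add a N n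
  have h2 := Finset.sum_range_add a n N
  rw [add_comm n N] at h2
  have h3 : ∀ b : ℕ → ℕ, |∑ j ∈ Finset.range N, a (b j)| ≤ N * C := fun b =>
    (Finset.abs_sum_le_sum_abs _ _).trans ((Finset.sum_le_sum fun j _ => hC (b j)).trans_eq
      (by simp))
  have h4 := abs_le.mp (h3 id)
  have h5 := abs_le.mp (h3 (n + ·))
  simp only [id] at h4
  rw [abs_le]
  constructor <;> linarith [h4.1, h4.2, h5.1, h5.2]

theorem IsLocalTest.cells_mem_deviantCells (hf : IsLocalTest N M K f) {C : ℝ}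
    (hC : ∀ p, |f p| ≤ C) {ω : Env d} {z : Steps d} {m ε : ℝ} {n : ℕ} (hn : 0 < n)
    (hnC : 2 * N * C ≤ n * (ε / 2)) (h : ε < |∫ p, f p ∂(empiricalProcess ω z n) - m|) :
    (fun i : Fin (n + (N + M + K + 1)) => cells ω z i) ∈ deviantCells N M K f m (ε / 2) n := by
  have hn' : (0 : ℝ) < n := Nat.cast_pos.mpr hn
  rw [mem_deviantCells_iff]
  simp_rw [← hf.seenFrom_eq_windowFun]
  rw [hf.integral_empiricalProcess] at h
  have h1 : n * ε < |∑ j ∈ Finset.range n, f (seenFrom ω z j) - n * m| := by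
    calc n * ε < n * |(n : ℝ)⁻¹ * ∑ j ∈ Finset.range n, f (seenFrom ω z j) - m| :=
          mul_lt_mul_of_pos_left h hn'
      _ = _ := by
        rw [← abs_of_pos hn', ← abs_mul, abs_of_pos hn', mul_sub, mul_inv_cancel_left₀ hn'.ne']
  have h2 := abs_sum_range_add_sub_le (fun j => hC (seenFrom ω z j)) N n
  have h3 := abs_sub_abs_le_abs_sub (∑ j ∈ Finset.range n, f (seenFrom ω z j) - n * m)
    (∑ j ∈ Finset.range n, f (seenFrom ω z (N + j)) - n * m)
  rw [sub_sub_sub_cancel_right, abs_sub_comm (∑ j ∈ Finset.range n, f (seenFrom ω z j))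
    (∑ j ∈ Finset.range n, f (seenFrom ω z (N + j)))] at h3
  linarith

variable {P : Measure (Env d)}

/-- The tilted quenched expectation of the event that the cells deviate. -/
def tiltedDeviation (P : Measure (Env d)) (θ : EuclideanSpace ℝ (Fin d)) (N M K : ℕ)
    (f : Env d × Steps d → ℝ) (m ε : ℝ) (n : ℕ) (ω : Env d) : ℝ :=
  ∫ z, Real.exp (inner ℝ θ (toE (pos z (n + (N + M + K + 1))))
      - ((n + (N + M + K + 1) : ℕ) : ℝ) * logMGF P θ) *
    (deviantCells N M K f m ε n).indicator (fun _ => 1) (fun i => cells ω z i) ∂(quenchedLaw ω)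

/-- The mean over the environment of the tilted quenched expectation is a deviation probability for
i.i.d. cells, so `abs_window_sum_tail` bounds it. -/
theorem IsEllipticIID.ae_tiltedDeviation_le [IsProbabilityMeasure P] (hP : IsEllipticIID P)
    (θ : EuclideanSpace ℝ (Fin d)) (hf : IsLocalTest N M K f) {ε : ℝ} (hε : 0 < ε) :
    ∃ γ > 0, ∀ᵐ ω ∂P, ∀ᶠ n : ℕ in atTop,
      tiltedDeviation P θ N M K f (∫ p, f p ∂(tiltedLaw P θ)) ε n ω ≤
        Real.exp (-(γ * n)) := by
  have := hP.isProbabilityMeasure_cellLaw θ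
  obtain ⟨C, hC⟩ := hf.bounded
  obtain ⟨γ, hγ, h⟩ := abs_window_sum_tail (cellLaw P θ) (Nat.succ_pos (N + M + K))
    hf.measurable_windowFun (IsLocalTest.abs_windowFun_le hC) hε
  set m := ∫ p, f p ∂(tiltedLaw P θ) with hm
  rw [← hP.integral_tiltedLaw θ hf, ← hm] at h
  have hGm : ∀ n, Measurable
      ((deviantCells N M K f m ε n).indicator fun _ => (1 : ℝ)) := fun n =>
    measurable_const.indicator (hf.measurableSet_deviantCells m ε n)
  have hGb : ∀ n v, |(deviantCells N M K f m ε n).indicator (fun _ => (1 : ℝ)) v| ≤ 1 :=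
    fun n v => abs_indicator_one_le _ v
  refine ⟨γ / 2, by positivity, ae_eventually_le_exp (A := 2 * (N + M + K + 1 : ℕ)) (γ := γ)
    (fun n ω => integral_nonneg fun z => mul_nonneg (Real.exp_pos _).le
      (Set.indicator_nonneg (fun _ _ => zero_le_one) _))
    (fun n => integrable_quenched_cells θ (hGm n) (hGb n)) hγ fun n => ?_⟩
  refine le_trans (le_of_eq ?_) (h n)
  refine (hP.averagedExp_cells θ (hGm n) (hGb n)).trans ?_
  have hinj : Function.Injective fun i : Fin (n + (N + M + K + 1)) => (i : ℕ) :=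
    Fin.val_injective
  have hrm : Measurable fun (w : ℕ → Cell d) (i : Fin (n + (N + M + K + 1))) => w i :=
    measurable_pi_lambda _ fun i => measurable_pi_apply _
  have hD := hf.measurableSet_deviantCells m ε n
  rw [integral_indicator_const _ hD, smul_eq_mul, mul_one, ← Measure.infinitePi_eq_pi,
    ← Measure.map_infinitePi_infinitePi_of_inj (P := fun _ : ℕ => cellLaw P θ) hinj,
    map_measureReal_apply hrm hD]
  congr 1
  ext w
  exact mem_deviantCells_iff w m ε n

/-- On the event, the tilt is bounded below by a deterministic `exp b`, so removing it costs at most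
the factor `exp (-b)`. -/
theorem IsLocalTest.measureReal_deviation_le (hf : IsLocalTest N M K f) {C : ℝ}
    (hC : ∀ p, |f p| ≤ C) (θ ξ : EuclideanSpace ℝ (Fin d)) (ω : Env d) {m ε δ : ℝ} {n : ℕ}
    (hn : 0 < n) (hnC : 2 * N * C ≤ n * (ε / 2)) :
    (quenchedLaw ω).real ({z | ‖velocity z n - ξ‖ ≤ δ} ∩
        {z | ε < |∫ p, f p ∂(empiricalProcess ω z n) - m|}) ≤
      Real.exp (-(n * (inner ℝ θ ξ - logMGF P θ - ‖θ‖ * δ)) +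
        (N + M + K + 1 : ℕ) * (‖θ‖ + |logMGF P θ|)) *
        tiltedDeviation P θ N M K f m (ε / 2) n ω := by
  set l := N + M + K + 1 with hl
  -- The first term comes from the velocity constraint at time `n`. The second pays for the `l`
  -- further steps needed to complete the last windows: each changes the exponent by at most `‖θ‖ +
  -- |logMGF P θ|`.
  set b := n * (inner ℝ θ ξ - logMGF P θ - ‖θ‖ * δ) - l * (‖θ‖ + |logMGF P θ|) with hb
  set S := {z : Steps d | ‖velocity z n - ξ‖ ≤ δ} ∩
    {z | ε < |∫ p, f p ∂(empiricalProcess ω z n) - m|} with hS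
  have hSdep : ∀ x y : Steps d, (∀ i < n + l, x i = y i) → (x ∈ S ↔ y ∈ S) := by
    intro x y hxy
    have h1 : pos x n = pos y n := pos_congr fun i hi => hxy i (by omega)
    have h2 : ∑ j ∈ Finset.range n, f (seenFrom ω x j) =
        ∑ j ∈ Finset.range n, f (seenFrom ω y j) := by
      refine Finset.sum_congr rfl fun j hj => ?_
      rw [Finset.mem_range] at hj
      rw [seenFrom, seenFrom, pos_congr fun i hi => hxy i (by omega)]
      exact hf.steps _ _ _ fun i hi => hxy _ (by omega)
    simp only [hS, Set.mem_inter_iff, Set.mem_ofPred_eq, velocity, h1,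
      hf.integral_empiricalProcess, h2]
  have hSm : MeasurableSet S := by
    have h1 : Measurable fun z => z ∈ S :=
      measurable_of_dependsOn_steps (n + l) fun x y h => propext (hSdep x y h)
    exact measurableSet_setOfPred.mpr h1
  have hFint : Integrable (fun z : Steps d => Real.exp (inner ℝ θ (toE (pos z (n + l)))
      - ((n + l : ℕ) : ℝ) * logMGF P θ) * (deviantCells N M K f m (ε / 2) n).indicator (fun _ => 1)
        (fun i => cells ω z i)) (quenchedLaw ω) := by
    refine integrable_quenchedLaw ω (n + l) fun x y h => ?_
    rw [pos_congr h]
    congr 2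
    funext i
    exact cells_congr_steps ω fun j hj => h j (by omega)
  have key : Real.exp b * (quenchedLaw ω).real S ≤ tiltedDeviation P θ N M K f m (ε / 2) n ω := by
    rw [mul_comm, ← smul_eq_mul, ← integral_indicator_const _ hSm]
    refine integral_mono ((integrable_const _).indicator hSm) hFint fun z => ?_
    by_cases hz : z ∈ S
    · have h1 := hf.cells_mem_deviantCells hC hn hnC hz.2
      simp only [Set.indicator_of_mem hz, Set.indicator_of_mem h1, mul_one]
      rw [Real.exp_le_exp]
      have h2 := inner_pos_ge (θ := θ) hn hz.1
      have h3 := inner_pos_add_ge θ z n l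
      have h4 : (l : ℝ) * logMGF P θ ≤ l * |logMGF P θ| :=
        mul_le_mul_of_nonneg_left (le_abs_self _) (Nat.cast_nonneg _)
      rw [← hl, Nat.cast_add, hb]
      linarith
    · simp only [Set.indicator_of_notMem hz]
      exact mul_nonneg (Real.exp_pos _).le (Set.indicator_nonneg (fun _ _ => zero_le_one) _)
  have h1 : Real.exp (-(n * (inner ℝ θ ξ - logMGF P θ - ‖θ‖ * δ)) +
      l * (‖θ‖ + |logMGF P θ|)) = (Real.exp b)⁻¹ := by
    rw [← Real.exp_neg, hb]
    congr 1
    ring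
  rw [h1, ← div_eq_inv_mul, le_div_iff₀ (Real.exp_pos _), mul_comm]
  exact key

theorem measurableSet_velocity_le (ξ : EuclideanSpace ℝ (Fin d)) (n : ℕ) (δ : ℝ) :
    MeasurableSet {z : Steps d | ‖velocity z n - ξ‖ ≤ δ} := by
  have h : Measurable fun z : Steps d => ‖velocity z n - ξ‖ :=
    measurable_of_dependsOn_steps n fun x y h => by rw [velocity, velocity, pos_congr h]
  exact measurableSet_le h measurable_const

theorem cond_le_exp {Q : Measure (Steps d)} [IsProbabilityMeasure Q] {D A : Set (Steps d)}
    (hD : MeasurableSet D) {a b : ℝ} (h1 : ENNReal.ofReal (Real.exp a) ≤ Q D)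
    (h2 : Q.real (D ∩ A) ≤ Real.exp b) :
    ProbabilityTheory.cond Q D A ≤ ENNReal.ofReal (Real.exp (b - a)) := by
  rw [cond_apply hD, sub_eq_neg_add, Real.exp_add, ENNReal.ofReal_mul (Real.exp_pos _).le,
    Real.exp_neg, ENNReal.ofReal_inv_of_pos (Real.exp_pos _)]
  refine mul_le_mul' (ENNReal.inv_le_inv.mpr h1) ?_
  rw [ENNReal.le_ofReal_iff_toReal_le (measure_ne_top _ _) (Real.exp_pos _).le]
  exact h2

/-- The quenched lower bound at velocity `ξ`, with the averaged rate. -/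
theorem eventually_le_quenchedLaw_velocity {ξ : EuclideanSpace ℝ (Fin d)} {ω : Env d} {η : ℝ}
    {I : EuclideanSpace ℝ (Fin d) → ℝ≥0∞} {J a : ℝ} (hI : ((I ξ : ℝ≥0∞) : EReal) ≤ J)
    (hω : ∀ G : Set (EuclideanSpace ℝ (Fin d)), MeasurableSet G → closure G ⊆ Metric.ball ξ η →
      -((⨅ x ∈ interior G, I x : ℝ≥0∞) : EReal) ≤
        liminf (fun n : ℕ => scaledLog n (quenchedLaw ω {z | velocity z n ∈ G})) atTop)
    {δ : ℝ} (hδ : 0 < δ) (hδη : δ < η) (ha : a < -J) :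
    ∀ᶠ n : ℕ in atTop, ENNReal.ofReal (Real.exp (n * a)) ≤
      quenchedLaw ω {z | ‖velocity z n - ξ‖ ≤ δ} := by
  have h1 := hω (Metric.closedBall ξ δ) measurableSet_closedBall (by
    rw [Metric.isClosed_closedBall.closure_eq]
    exact Metric.closedBall_subset_ball hδη)
  have hξ : ξ ∈ interior (Metric.closedBall ξ δ) :=
    Metric.ball_subset_interior_closedBall (Metric.mem_ball_self hδ)
  have h2 : ((⨅ x ∈ interior (Metric.closedBall ξ δ), I x : ℝ≥0∞) : EReal) ≤ J :=
    (EReal.coe_ennreal_le_coe_ennreal_iff.mpr (iInf₂_le ξ hξ)).trans hI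
  have h3 : (a : EReal) < liminf (fun n : ℕ =>
      scaledLog n (quenchedLaw ω {z | velocity z n ∈ Metric.closedBall ξ δ})) atTop := by
    refine lt_of_lt_of_le ?_ ((EReal.neg_le_neg_iff.mpr h2).trans h1)
    rw [← EReal.coe_neg]
    exact EReal.coe_lt_coe_iff.mpr ha
  filter_upwards [eventually_lt_of_lt_liminf h3, eventually_gt_atTop 0] with n hn hn0
  have := le_of_lt_scaledLog hn0 hn
  simpa only [Metric.mem_closedBall, dist_eq_norm] using this

/-- Of the gain `γ`, one quarter is given to the lower bound for the conditioning event, one to `‖θ‖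
* δ` and one to the constant `c`, so the rate `-γ/4` remains. The smaller threshold `ε'` lets the
almost sure input come from a countable family. -/
theorem IsLocalTest.limsup_scaledLog_cond_lt_zero (hf : IsLocalTest N M K f)
    {θ ξ : EuclideanSpace ℝ (Fin d)} {ω : Env d} {m ε ε' γ η : ℝ} (hε : 0 < ε') (hle : ε' ≤ ε) (hγ : 0 < γ)
    (hη : 0 < η)
    (hr : ∀ᶠ n : ℕ in atTop, tiltedDeviation P θ N M K f m (ε' / 2) n ω ≤ Real.exp (-(γ * n)))
    (hD : ∀ δ a : ℝ, 0 < δ → δ < η → a < -(inner ℝ θ ξ - logMGF P θ) →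
      ∀ᶠ n : ℕ in atTop, ENNReal.ofReal (Real.exp (n * a)) ≤
        quenchedLaw ω {z | ‖velocity z n - ξ‖ ≤ δ}) :
    limsup (fun δ : ℝ => limsup (fun n : ℕ => scaledLog n
      (ProbabilityTheory.cond (quenchedLaw ω) {z | ‖velocity z n - ξ‖ ≤ δ}
        {z | ε < |∫ p, f p ∂(empiricalProcess ω z n) - m|}))
      atTop) (𝓝[>] (0 : ℝ)) < 0 := by
  obtain ⟨C, hC⟩ := hf.bounded
  set J := inner ℝ θ ξ - logMGF P θ with hJ
  set c := ((N + M + K + 1 : ℕ) : ℝ) * (‖θ‖ + |logMGF P θ|) with hc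
  have hev : ∀ᶠ δ : ℝ in 𝓝[>] 0, 0 < δ ∧ δ < η ∧ ‖θ‖ * δ ≤ γ / 4 := by
    have h1 : Tendsto (fun δ : ℝ => ‖θ‖ * δ) (𝓝 0) (𝓝 (‖θ‖ * 0)) :=
      Continuous.tendsto (by fun_prop) 0
    rw [mul_zero] at h1
    have h2 : ∀ᶠ δ : ℝ in 𝓝 0, ‖θ‖ * δ < γ / 4 := h1.eventually (gt_mem_nhds (by positivity))
    have h3 : ∀ᶠ δ : ℝ in 𝓝 0, δ < η := gt_mem_nhds hη
    filter_upwards [self_mem_nhdsWithin, nhdsWithin_le_nhds h2, nhdsWithin_le_nhds h3]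
      with δ h4 h5 h6
    exact ⟨h4, h6, h5.le⟩
  have hlim : ∀ B : ℝ, ∀ b : ℝ, 0 < b → ∀ᶠ n : ℕ in atTop, B ≤ n * b := by
    intro B b hb
    exact (tendsto_natCast_atTop_atTop.atTop_mul_const hb).eventually_ge_atTop B
  have hneg : ((-(γ / 4) : ℝ) : EReal) < 0 := by
    exact_mod_cast (by linarith : -(γ / 4) < (0 : ℝ))
  refine lt_of_le_of_lt (limsup_le_of_le (by isBoundedDefault) ?_) hneg
  filter_upwards [hev] with δ ⟨hδ, hδη, hδγ⟩
  refine limsup_le_of_le (by isBoundedDefault) ?_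
  filter_upwards [hr, hD δ (-(J + γ / 4)) hδ hδη (by linarith), eventually_gt_atTop 0,
    hlim (2 * N * C) (ε' / 2) (by positivity), hlim c (γ / 4) (by positivity)]
    with n hr hD hn hnC hnc
  refine scaledLog_le hn ?_
  have h1 := hf.measureReal_deviation_le (P := P) hC θ ξ ω (m := m) (δ := δ) hn hnC
  have h2 : (quenchedLaw ω).real ({z | ‖velocity z n - ξ‖ ≤ δ} ∩
      {z | ε < |∫ p, f p ∂(empiricalProcess ω z n) - m|}) ≤
      Real.exp (-(n * (J - ‖θ‖ * δ)) + c - γ * n) := by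
    rw [sub_eq_add_neg _ (γ * n), Real.exp_add]
    exact (measureReal_mono (Set.inter_subset_inter_right _ fun z hz => hle.trans_lt hz)
      (measure_ne_top _ _)).trans (h1.trans (mul_le_mul_of_nonneg_left hr (Real.exp_pos _).le))
  refine (cond_le_exp (measurableSet_velocity_le ξ n δ) hD h2).trans ?_
  refine ENNReal.ofReal_le_ofReal (Real.exp_le_exp.mpr ?_)
  have h3 : (n : ℝ) * (‖θ‖ * δ) ≤ n * (γ / 4) :=
    mul_le_mul_of_nonneg_left hδγ (Nat.cast_nonneg n)
  linarith

end

end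

end SpaceTimeRWRE

/-! ### The main theorem. -/

open SpaceTimeRWRE
theorem theorem1p19 (d : ℕ) (P : Measure (Env d)) [IsProbabilityMeasure P]
    (hP : IsEllipticIID P) (ξ : EuclideanSpace ℝ (Fin d))
    (hξ : ξ ∈ interior (velocityDomain d)) (hLDP : QuenchedLDPNear P ξ) :
    (∃! μ : Measure (Env d × Steps d), IsTiltedLaw P ξ μ) ∧
    ∀ μ : Measure (Env d × Steps d), IsTiltedLaw P ξ μ →
      ∀ (N M K : ℕ) (f : Env d × Steps d → ℝ), IsLocalTest N M K f →
        ∀ᵐ ω ∂P, ∀ ε : ℝ, 0 < ε →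
          limsup (fun δ : ℝ => limsup (fun n : ℕ => scaledLog n
            (ProbabilityTheory.cond (quenchedLaw ω) {z | ‖velocity z n - ξ‖ ≤ δ}
              {z | ε < |∫ p, f p ∂(empiricalProcess ω z n) - ∫ p, f p ∂μ|}))
            atTop) (𝓝[>] (0 : ℝ)) < 0 := by
  constructor
  · obtain ⟨θ, hθ⟩ := hP.exists_hasGradientAt hξ
    have := hP.isProbabilityMeasure_tiltedLaw θ
    refine ⟨tiltedLaw P θ, ⟨θ, hθ, fun N M K f hf =>
      (hP.averagedExp_eq_integral_tiltedLaw θ hf).symm⟩, ?_⟩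
    rintro μ ⟨θ', hθ', hμ⟩
    obtain rfl := hP.hasGradientAt_injective hθ hθ'
    exact ext_of_localTests fun N M K f hf =>
      (hμ N M K f hf).trans (hP.averagedExp_eq_integral_tiltedLaw θ' hf)
  · rintro μ ⟨θ, hθ, hμ⟩ N M K f hf
    rw [(hμ N M K f hf).trans (hP.averagedExp_eq_integral_tiltedLaw θ hf)]
    obtain ⟨η, I, hη, -, hI, hω⟩ := hLDP
    -- The countably many thresholds `1 / (k + 1)` yield a single null set that serves every `ε >
    -- 0`.
    have hε' : ∀ k : ℕ, (0 : ℝ) < 1 / ((k : ℝ) + 1) := fun k => by positivity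
    choose γ hγ hr using fun k => hP.ae_tiltedDeviation_le θ hf (half_pos (hε' k))
    filter_upwards [hω, ae_all_iff.2 hr] with ω hω hr ε hε
    obtain ⟨k, hk⟩ := exists_nat_one_div_lt hε
    exact hf.limsup_scaledLog_cond_lt_zero (hε' k) hk.le (hγ k) hη (hr k) fun δ a hδ hδη ha =>
      eventually_le_quenchedLaw_velocity (hI.le.trans (hP.averagedRate_le hθ))
        (fun G hG hGη => (hω G hG hGη).1) hδ hδη ha
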